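/- **Setting.** There are $n$ buyers and a nonempty finite set of $m$ items, with $k_j\ge 1$ units of item $j$; let $k=\min_j k_j$. Buyer $i$ has a type $t_i\in T_i$; the types are independent, $t_i\sim D_i$. An outcome of a buyer is a set of items (at most one unit of each) and a real payment. Buyer $i$ has a utility function $u_i$ with values in $[-\infty,\infty]$, and the objective is $\sum_i \mathrm{Obj}_i(t_i,\text{outcome of } i)$ with real-valued $\mathrm{Obj}_i$. (Expectations are $E[f^+]-E[f^-]$; if this is $\infty-\infty$ it counts as $-\infty$.) A mechanism maps reported type profiles to probability distributions on outcome profiles. For a mechanism $M$, let $[[M]]_i$ be the single-buyer mechanism perceived by buyer $i$ when the other types are drawn from their priors. Let $\mathcal M$ be a space of feasible mechanisms, and $\mathcal M_i=\{[[M]]_i : M\in\mathcal M\}$. Assume that $\mathcal M$ is closed under running one of two of its members chosen at random with fixed probabilities, and that it is decomposable: every $M\in\mathcal M$ satisfies the supply constraints (for every type profile, almost surely at most $k_j$ units of each item $j$ are allocated), and every mechanism $M$ that satisfies the supply constraints and has $[[M]]_i\in\mathcal M_i$ for all $i$ is in $\mathcal M$. **Single-buyer mechanisms.** Let $\alpha\ge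 0$. For every buyer $i$ let there be a concave benchmark $R_i:[0,1]^m\to\mathbb R_{\ge0}$ and, for every $x\in[0,1]^m$, a mechanism $M_i\langle x\rangle\in\mathcal M_i$ that is incentive compatible (for every type, truthful reporting maximizes the expected utility $u_i$), whose ex ante probability of allocating item $j$ is at most $x_j$ for every $j$, and which, for every type, almost surely does not allocate items $j$ with $x_j=0$. Assume that these provide an $\alpha$-approximation: the expected objective of $M_i\langle x\rangle$ is at least $\alpha R_i(x)$, and the expected objective of every $N\in\mathcal M_i$ with ex ante allocation probabilities at most $x$ is at most $R_i(x)$. For a set $S$ of items let $x[S]$ be $x$ with the entries outside $S$ replaced by $0$. Assume that $R_i$ has a budget-balanced cross-monotonic cost-sharing scheme: there is $\xi_i\ge0$ such that $\sum_{j\in S}\xi_i(j,x[S])=R_i(x[S])$ and $\xi_i(j,x[S])\ge\xi_i(j,x[S\cup S'])$ for all $x\in[0,1]^m$, all sets $S,S'$ of items and all $j\in S$. **Magicians.** The $\gamma$-conservative magician for boxes with written probabilities $x_1,x_2,\dots$ uses $F_1(l)=1$ for $l\ge0$, $F_i(l)=0$ for $l<0$, $\theta_i=\min\{l\ge 0: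 F_i(l)\ge\gamma\}$, opening probabilities $s_i^l=1$ for $l<\theta_i$, $s_i^{\theta_i}=\frac{\gamma-F_i(\theta_i-1)}{F_i(\theta_i)-F_i(\theta_i-1)}$ and $s_i^l=0$ for $l>\theta_i$, and $F_{i+1}(l)=s_i^lx_iF_i(l-1)+(1-s_i^lx_i)F_i(l)$ for $l\ge0$; it opens box $i$ with probability $s_i^w$ if $w$ wands have been broken before. Let $\gamma_k$ be the largest $\gamma\in[0,1]$ such that for all $k'\ge k$ and all finite sequences of boxes with $x_i\in[0,1]$ and $\sum_i x_i\le k'$, all thresholds satisfy $\theta_i<k'$. **$\gamma$-Pre-rounding.** Let $\hat x$ be an optimal solution of the program: maximize $\sum_i R_i(x_i)$ subject to $x_i\in[0,1]^m$ and $\sum_i x_{ij}\le k_j$ for all $j$. Give each item $j$ a $\gamma$-conservative magician; the magicians randomize independently. Serve the buyers $i=1,\dots,n$ one after the other (in an arbitrary fixed order): present a box with $\hat x_{ij}$ written on it to the magician of item $j$, for every $j$; let $S_i$ be the set of items whose box was opened; run $M_i\langle\hat x_i[S_i]\rangle$ on buyer $i$ and use its outcome for buyer $i$; for every item allocated to her,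 break a wand of the magician of that item. **Theorem.** For every $\gamma\in[0,\gamma_k]$ and every such $\hat x$, the $\gamma$-pre-rounding mechanism is dominant strategy incentive compatible (for every type profile reported by the others, and every true type, truthful reporting maximizes a buyer's expected utility), it is in $\mathcal M$, and it is a $\gamma\alpha$-approximation of the optimal mechanism in $\mathcal M$: its expected objective is at least $\gamma\alpha$ times the expected objective of every mechanism in $\mathcal M$. -/

import Mathlib

open MeasureTheory ProbabilityTheory
open scoped ENNReal NNReal

namespace Auction

/-! ## Outcomes, randomized mechanisms, expectations -/

/-- The outcome of one buyer: which items she receives (at most one unit of each item, `true`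
meaning that a unit is allocated) and her payment. -/
abbrev Outcome (ι : Type*) : Type _ := (ι → Bool) × ℝ

/-- A randomized direct mechanism: to every report `x : X` it assigns a probability distribution
on the results `Y`, measurably in `x`. -/
abbrev Mech (X Y : Type*) [MeasurableSpace X] [MeasurableSpace Y] : Type _ :=
  {κ : Kernel X Y // IsMarkovKernel κ}

instance {X Y : Type*} [MeasurableSpace X] [MeasurableSpace Y] (M : Mech X Y) :
    IsMarkovKernel M.1 := M.2

/-- Extended expectation `E[f⁺] - E[f⁻]`. The undefined case `∞ - ∞` has the value `-∞`. -/
noncomputable def expect {Ω : Type*} [MeasurableSpace Ω] (μ : Measure Ω) (f : Ω → EReal) : EReal :=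
  ((∫⁻ a, (f a).toENNReal ∂μ : ℝ≥0∞) : EReal) - ((∫⁻ a, (-f a).toENNReal ∂μ : ℝ≥0∞) : EReal)

/-! ## Single buyer mechanisms -/

section Single

variable {ι T : Type*} [MeasurableSpace T]

/-- The ex ante probability of allocating a unit of item `j`, over the buyer's type and the
randomness of the mechanism. -/
noncomputable def exAnte (D : Measure T) (N : Mech T (Outcome ι)) (j : ι) : ℝ :=
  (D ⊗ₘ N.1).real {z | z.2.1 j = true}

/-- The expected objective value obtained from one buyer. -/
noncomputable def singleValue (D : Measure T) (obj : T → Outcome ι → ℝ)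
    (N : Mech T (Outcome ι)) : EReal :=
  expect (D ⊗ₘ N.1) (fun z => (obj z.1 z.2 : EReal))

/-- Incentive compatibility: for every type, reporting truthfully maximizes expected utility. -/
def IsIC (util : T → Outcome ι → EReal) (N : Mech T (Outcome ι)) : Prop :=
  ∀ t t' : T, expect (N.1 t') (util t) ≤ expect (N.1 t) (util t)

/-- `x[S]`: the entries of `x` at the items outside `S` are replaced by zero. -/
def induced [DecidableEq ι] (x : ι → ℝ) (S : Finset ι) : ι → ℝ :=
  fun j => if j ∈ S then x j else 0

/-- The unit cube `[0,1]^ι` of upper bounds on ex ante allocation probabilities. -/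
abbrev cube (ι : Type*) : Set (ι → ℝ) := Set.Icc 0 1

/-- The mechanisms `mech x` (one for every upper bound `x` on the ex ante allocation) together with
the concave benchmark `R` provide an `α`-approximation of the optimal single buyer
mechanism / optimal benchmark within the class `C` of feasible single buyer mechanisms. -/
structure IsApproxSingle (D : Measure T) (obj : T → Outcome ι → ℝ)
    (C : Set (Mech T (Outcome ι))) (α : ℝ) (mech : (ι → ℝ) → Mech T (Outcome ι))
    (R : (ι → ℝ) → ℝ) : Prop where
  mem : ∀ x ∈ cube ι, mech x ∈ C
  exAnte_le : ∀ x ∈ cube ι, ∀ j, exAnte D (mech x) j ≤ x j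
  concave : ConcaveOn ℝ (cube ι) R
  upper : ∀ x ∈ cube ι, ∀ N ∈ C, (∀ j, exAnte D N j ≤ x j) → singleValue D obj N ≤ (R x : EReal)
  lower : ∀ x ∈ cube ι, ((α * R x : ℝ) : EReal) ≤ singleValue D obj (mech x)

/-- `R` has a budget balanced cross monotonic cost sharing scheme: nonnegative cost shares `ξ j x`
that sum to `R`, and the share of an offered item does not increase if more items are offered. -/
def HasCostSharing [DecidableEq ι] (R : (ι → ℝ) → ℝ) : Prop :=
  (∀ x ∈ cube ι, 0 ≤ R x) ∧
  ∃ ξ : ι → (ι → ℝ) → ℝ,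
    (∀ j, ∀ x ∈ cube ι, 0 ≤ ξ j x) ∧
    (∀ x ∈ cube ι, ∀ S : Finset ι, ∑ j ∈ S, ξ j (induced x S) = R (induced x S)) ∧
    (∀ x ∈ cube ι, ∀ S S' : Finset ι, ∀ j ∈ S,
      ξ j (induced x (S ∪ S')) ≤ ξ j (induced x S))

end Single

/-! ## Multi buyer mechanisms -/

section Multi

variable {n : ℕ} {ι : Type*} {T : Fin n → Type*} [∀ i, MeasurableSpace (T i)]

/-- Supply constraints: for every type profile, (almost surely) no more units of an item are
allocated than there are. -/
def Supply [DecidableEq ι] (k : ι → ℕ) (M : Mech (∀ i, T i) (Fin n → Outcome ι)) : Prop :=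
  ∀ θ, ∀ᵐ o ∂(M.1 θ), ∀ j, (Finset.univ.filter fun i => (o i).1 j = true).card ≤ k j

/-- The single buyer mechanism perceived by buyer `i`: given her report `t`, draw the types of the
others at random, run `M`, and return the outcome of buyer `i`. -/
noncomputable def inducedMech (D : ∀ i, Measure (T i)) [∀ i, IsProbabilityMeasure (D i)]
    (i : Fin n) (M : Mech (∀ i, T i) (Fin n → Outcome ι)) : Mech (T i) (Outcome ι) :=
  ⟨(M.1 ∘ₖ ((Kernel.id ×ₖ Kernel.const (T i) (Measure.pi D)).map
      (fun p : T i × (∀ i, T i) => Function.update p.2 i p.1))).map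
      (fun o : Fin n → Outcome ι => o i), by
    have h1 : Measurable (fun p : T i × (∀ i, T i) => Function.update p.2 i p.1) := by
      rw [measurable_pi_iff]
      intro a
      by_cases h : a = i
      · subst h
        simpa using measurable_fst
      · simp only [Function.update_of_ne h]
        exact (measurable_pi_apply a).comp measurable_snd
    have := Kernel.IsMarkovKernel.map (Kernel.id ×ₖ Kernel.const (T i) (Measure.pi D)) h1
    exact Kernel.IsMarkovKernel.map _ (measurable_pi_apply i)⟩

/-- The class of feasible single buyer mechanisms for buyer `i`. -/
def singleClass (D : ∀ i, Measure (T i)) [∀ i, IsProbabilityMeasure (D i)]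
    (C : Set (Mech (∀ i, T i) (Fin n → Outcome ι))) (i : Fin n) : Set (Mech (T i) (Outcome ι)) :=
  inducedMech D i '' C

/-- The space of mechanisms is convex: running one of two feasible mechanisms, chosen at random with
fixed probabilities, is feasible. -/
def IsConvexClass {X Y : Type*} [MeasurableSpace X] [MeasurableSpace Y]
    (C : Set (Mech X Y)) : Prop :=
  ∀ M ∈ C, ∀ M' ∈ C, ∀ β : ℝ≥0, β ≤ 1 → ∀ M'' : Mech X Y,
    (∀ x, M''.1 x = β • M.1 x + (1 - β) • M'.1 x) → M'' ∈ C

/-- The constraints specifying the space of mechanisms decompose into the supply constraints and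
single buyer constraints. -/
def IsDecomposable [DecidableEq ι] (k : ι → ℕ) (D : ∀ i, Measure (T i))
    [∀ i, IsProbabilityMeasure (D i)] (C : Set (Mech (∀ i, T i) (Fin n → Outcome ι))) : Prop :=
  (∀ M ∈ C, Supply k M) ∧
  ∀ M, Supply k M → (∀ i, inducedMech D i M ∈ singleClass D C i) → M ∈ C

/-- The expected value of the (linearly separable) objective. -/
noncomputable def value (D : ∀ i, Measure (T i)) (obj : ∀ i, T i → Outcome ι → ℝ)
    (M : Mech (∀ i, T i) (Fin n → Outcome ι)) : EReal :=
  ∑ i, expect (Measure.pi D ⊗ₘ M.1) (fun z => (obj i (z.1 i) (z.2 i) : EReal))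

/-- `M` is a `c`-approximation of the optimal mechanism in `C`: it is feasible and obtains at least
a `c`-fraction of the value of every feasible mechanism. -/
def IsApproxOptimal (D : ∀ i, Measure (T i)) (obj : ∀ i, T i → Outcome ι → ℝ)
    (C : Set (Mech (∀ i, T i) (Fin n → Outcome ι))) (c : ℝ)
    (M : Mech (∀ i, T i) (Fin n → Outcome ι)) : Prop :=
  M ∈ C ∧ ∀ M' ∈ C, (c : EReal) * value D obj M' ≤ value D obj M

/-- Dominant strategy incentive compatibility: whatever the other buyers report, truthful reporting
maximizes the expected utility of buyer `i`. -/
def IsDSIC (util : ∀ i, T i → Outcome ι → EReal)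
    (M : Mech (∀ i, T i) (Fin n → Outcome ι)) : Prop :=
  ∀ (i : Fin n) (θ : ∀ i, T i) (t' : T i),
    expect (M.1 (Function.update θ i t')) (fun o => util i (θ i) (o i)) ≤
      expect (M.1 θ) (fun o => util i (θ i) (o i))

/-- Feasible assignments of the benchmark program. -/
def IsAssignment (k : ι → ℕ) (x : Fin n → ι → ℝ) : Prop :=
  (∀ i, x i ∈ cube ι) ∧ ∀ j, ∑ i, x i j ≤ k j

/-- Optimal assignments of the benchmark program: maximize `∑ i, R i (x i)`. -/
def IsOptimalAssignment (k : ι → ℕ) (R : Fin n → (ι → ℝ) → ℝ) (x : Fin n → ι → ℝ) : Prop :=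
  IsAssignment k x ∧ ∀ y, IsAssignment k y → ∑ i, R i (y i) ≤ ∑ i, R i (x i)

end Multi

/-! ## The conservative magician

Boxes are numbered from `0`; `x i` is the number written on box `i`. A CDF is a function on `ℤ`. -/

/-- The smallest threshold `l` with `F l ≥ γ`. -/
noncomputable def thresholdOf (γ : ℝ) (F : ℤ → ℝ) : ℕ := sInf {l : ℕ | γ ≤ F l}

/-- The probability of opening the box if `l` wands are broken and the (computed) CDF of the number
of broken wands is `F`. -/
noncomputable def openProbOf (γ : ℝ) (F : ℤ → ℝ) (l : ℤ) : ℝ :=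
  if l < thresholdOf γ F then 1
  else if l = thresholdOf γ F then (γ - F (l - 1)) / (F l - F (l - 1))
  else 0

/-- The CDF, computed by the magician, of the number of wands broken before box `i`. -/
noncomputable def brokenCDF (γ : ℝ) (x : ℕ → ℝ) : ℕ → ℤ → ℝ
  | 0, l => if 0 ≤ l then 1 else 0
  | i + 1, l =>
    if 0 ≤ l then
      openProbOf γ (brokenCDF γ x i) l * x i * brokenCDF γ x i (l - 1) +
        (1 - openProbOf γ (brokenCDF γ x i) l * x i) * brokenCDF γ x i l
    else 0

/-- The threshold for box `i`. -/
noncomputable def threshold (γ : ℝ) (x : ℕ → ℝ) (i : ℕ) : ℕ := thresholdOf γ (brokenCDF γ x i)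

/-- The probability of opening box `i` if `w` wands are broken. -/
noncomputable def openProb (γ : ℝ) (x : ℕ → ℝ) (i : ℕ) (w : ℕ) : ℝ :=
  openProbOf γ (brokenCDF γ x i) w

/-- `gammaOpt k` is the largest probability `γ` such that for every `k' ≥ k` and every instance of
the magician's problem with `k'` wands (`N` boxes with probabilities that sum to at most `k'`), all
thresholds computed by the `γ`-conservative magician are less than `k'`. -/
noncomputable def gammaOpt (k : ℕ) : ℝ :=
  sSup {γ : ℝ | 0 ≤ γ ∧ γ ≤ 1 ∧ ∀ k' : ℕ, k ≤ k' → ∀ (N : ℕ) (x : ℕ → ℝ),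
    (∀ i < N, 0 ≤ x i ∧ x i ≤ 1) → ∑ i ∈ Finset.range N, x i ≤ k' →
      ∀ i < N, threshold γ x i < k'}

/-! ## Pre-rounding -/

section PreRounding

variable {n : ℕ} {ι : Type*} [Fintype ι] [DecidableEq ι] {T : Fin n → Type*}
  [∀ i, MeasurableSpace (T i)]

/-- The sequence of boxes presented to the magician of item `j`. -/
def boxes (x : Fin n → ι → ℝ) (j : ι) : ℕ → ℝ := fun i => if h : i < n then x ⟨i, h⟩ j else 0

/-- Given the numbers `w j` of broken wands, each magician independently decides whether to open
box `i`. The result is the indicator of the set of opened boxes. -/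
noncomputable def openLaw (γ : ℝ) (x : Fin n → ι → ℝ) (i : Fin n) :
    Kernel (ι → ℕ) (ι → Bool) :=
  Kernel.ofFunOfCountable fun w => Measure.pi fun j =>
    bernoulliMeasure true false
      (Set.projIcc (0 : ℝ) 1 zero_le_one (openProb γ (boxes x j) i (w j)))

instance (γ : ℝ) (x : Fin n → ι → ℝ) (i : Fin n) : IsMarkovKernel (openLaw γ x i) :=
  ⟨fun w => by
    change IsProbabilityMeasure (Measure.pi _)
    infer_instance⟩

/-- Given the indicator `s` of the set `S` of opened boxes and a type `t`, run `mech (x[S])` on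
`t`. -/
noncomputable def runLaw {X : Type*} [MeasurableSpace X] (mech : (ι → ℝ) → Mech X (Outcome ι))
    (x : ι → ℝ) : Kernel ((ι → Bool) × X) (Outcome ι) where
  toFun p := (mech (induced x (Finset.univ.filter fun j => p.1 j = true))).1 p.2
  measurable' := measurable_from_prod_countable_right fun s =>
    (mech (induced x (Finset.univ.filter fun j => s j = true))).1.measurable

instance {X : Type*} [MeasurableSpace X] (mech : (ι → ℝ) → Mech X (Outcome ι))
    (x : ι → ℝ) : IsMarkovKernel (runLaw mech x) :=
  ⟨fun p => by
    change IsProbabilityMeasure ((mech _).1 p.2)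
    infer_instance⟩

/-- The state of the sequential mechanism: the number of broken wands of each magician, and the
outcomes so far (buyers who have not been served yet have the empty outcome). -/
abbrev State (n : ℕ) (ι : Type*) : Type _ := (ι → ℕ) × (Fin n → Outcome ι)

/-- Record the outcome `o` of buyer `i`, and break a wand of the magician of every item of which a
unit is allocated to her. -/
def record (i : Fin n) (q : State n ι) (o : Outcome ι) : State n ι :=
  (fun j => q.1 j + (if o.1 j = true then 1 else 0), Function.update q.2 i o)

set_option linter.unusedSectionVars false in
theorem measurable_record (i : Fin n) :
    Measurable fun p : State n ι × Outcome ι => record i p.1 p.2 := by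
  unfold record
  refine Measurable.prodMk ?_ ?_
  · rw [measurable_pi_iff]
    intro j
    have h : Measurable fun b : Bool => if b = true then 1 else 0 := measurable_of_countable _
    have h2 : Measurable fun p : State n ι × Outcome ι => p.2.1 j := by fun_prop
    have h3 : Measurable fun p : State n ι × Outcome ι => p.1.1 j := by fun_prop
    exact h3.add (h.comp h2)
  · rw [measurable_pi_iff]
    intro a
    by_cases h : a = i
    · subst h
      simpa using measurable_snd
    · simp only [Function.update_of_ne h]
      fun_prop

/-- Serving buyer `i`: write `x i j` on a box for the magician of item `j`, for every item `j`; run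
`mech i` subject to `x i` restricted to the opened boxes; record the outcome. -/
noncomputable def serve (γ : ℝ) (x : Fin n → ι → ℝ)
    (mech : ∀ i, (ι → ℝ) → Mech (T i) (Outcome ι)) (i : Fin n) :
    Kernel ((∀ i, T i) × State n ι) (State n ι) :=
  (Kernel.id ×ₖ
      ((openLaw γ x i).comap (fun z : (∀ i, T i) × State n ι => z.2.1) (by fun_prop) ⊗ₖ
        (runLaw (mech i) (x i)).comap
          (fun z : ((∀ i, T i) × State n ι) × (ι → Bool) => (z.2, z.1.1 i)) (by fun_prop))).map
    (fun z => record i z.1.2 z.2.2)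

instance (γ : ℝ) (x : Fin n → ι → ℝ) (mech : ∀ i, (ι → ℝ) → Mech (T i) (Outcome ι))
    (i : Fin n) : IsMarkovKernel (serve γ x mech i) :=
  Kernel.IsMarkovKernel.map _ ((measurable_record i).comp
    (f := fun z : ((∀ i, T i) × State n ι) × ((ι → Bool) × Outcome ι) => (z.1.2, z.2.2))
    (by fun_prop))

/-- The state after the first `r` buyers have been served, as a function of the reports. -/
noncomputable def stateAfter (γ : ℝ) (x : Fin n → ι → ℝ)
    (mech : ∀ i, (ι → ℝ) → Mech (T i) (Outcome ι)) : ℕ → Kernel (∀ i, T i) (State n ι)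
  | 0 => Kernel.const _ (Measure.dirac (fun _ => 0, fun _ => (fun _ => false, 0)))
  | r + 1 =>
    if h : r < n then serve γ x mech ⟨r, h⟩ ∘ₖ (Kernel.id ×ₖ stateAfter γ x mech r)
    else stateAfter γ x mech r

instance (γ : ℝ) (x : Fin n → ι → ℝ) (mech : ∀ i, (ι → ℝ) → Mech (T i) (Outcome ι)) (r : ℕ) :
    IsMarkovKernel (stateAfter γ x mech r) := by
  induction r with
  | zero => unfold stateAfter; infer_instance
  | succ r ih =>
    unfold stateAfter
    split
    · infer_instance
    · exact ih

/-- The `γ`-pre-rounding mechanism for the assignment `x`: the buyers are served in the order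
`0, 1, …, n - 1`. -/
noncomputable def preRounding (γ : ℝ) (x : Fin n → ι → ℝ)
    (mech : ∀ i, (ι → ℝ) → Mech (T i) (Outcome ι)) : Mech (∀ i, T i) (Fin n → Outcome ι) :=
  ⟨(stateAfter γ x mech n).map (fun q => q.2), Kernel.IsMarkovKernel.map _ measurable_snd⟩

end PreRounding

end Auction

/-! The set of items offered to buyer `i` depends only on the reports of the buyers served before
her. Given all other reports, her outcome is therefore a mixture of the mechanisms `mech i (offered
(x i) s)` with weights she cannot influence (`map_preRounding`), and a fixed mixture of incentive
compatible mechanisms is incentive compatible. Averaging the weights over the types shows that her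
perceived mechanism is a fixed mixture of members of the convex class `singleClass D C i`
(`inducedMech_preRounding`). By decomposability, feasibility then only needs the supply constraints:
a box is opened only if at most `θ` wands are broken, `θ < k j` for `γ ≤ gammaOpt`, and items not
offered are not allocated.

For the approximation, the ex ante allocations of any feasible mechanism are feasible for the
benchmark program, so its value is at most `∑ i, R i (x i)` (`value_le_sum`). Conversely, every item
is offered to every buyer with probability at least `γ` (`le_avgOfferLaw`): averaged over
independent types, an opened box breaks a wand with probability at most the number written on it, so
the true number of broken wands is stochastically dominated by the one the magician computes
(`brokenCDF_le_bind_stateAfter`). The opening probability decreases in that number and has mean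
exactly `γ` under the computed law. Offers of different items may be correlated. Cross-monotonicity
makes this harmless: an item of `S` carries at least its share in the full `x`, so `E R(x[S]) ≥ ∑ j,
P(j ∈ S) ξ j x ≥ γ R x` (`HasCostSharing.mul_le_sum`).

It remains to see that the supremum `gammaOpt` is attained and that smaller `γ` inherit its
threshold bound. Both follow from the threshold-free recursion `brokenCDF_succ`, which is continuous
in `γ` and yields CDFs that decrease in `γ`. -/

namespace Auction

/-! ## Analysis of the conservative magician -/

/-- A cumulative distribution function of a bounded natural number. -/
structure IsCountCDF (F : ℤ → ℝ) : Prop where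
  mono : Monotone F
  neg : ∀ l < 0, F l = 0
  le_one : ∀ l, F l ≤ 1
  eq_one : ∃ L : ℕ, F L = 1

theorem IsCountCDF.nonneg {F : ℤ → ℝ} (hF : IsCountCDF F) (l : ℤ) : 0 ≤ F l := by
  rcases lt_or_ge l 0 with h | h
  · exact (hF.neg l h).ge
  · exact (hF.neg (-1) (by norm_num)).symm.le.trans (hF.mono (by omega))

theorem IsCountCDF.le_thresholdOf {F : ℤ → ℝ} (hF : IsCountCDF F) {γ : ℝ} (hγ1 : γ ≤ 1) :
    γ ≤ F (thresholdOf γ F) := by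
  obtain ⟨L, hL⟩ := hF.eq_one
  exact Nat.sInf_mem (s := {l : ℕ | γ ≤ F l}) ⟨L, by simpa [hL] using hγ1⟩

theorem lt_of_lt_thresholdOf {F : ℤ → ℝ} {γ : ℝ} {l : ℕ} (h : l < thresholdOf γ F) : F l < γ :=
  not_le.1 (Nat.notMem_of_lt_sInf (s := {l : ℕ | γ ≤ F l}) h)

theorem IsCountCDF.thresholdOf_sub_one_le {F : ℤ → ℝ} (hF : IsCountCDF F) {γ : ℝ} (hγ0 : 0 ≤ γ) :
    F (thresholdOf γ F - 1) ≤ γ := by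
  rcases Nat.eq_zero_or_pos (thresholdOf γ F) with h | h
  · rw [h, hF.neg _ (by norm_num)]
    exact hγ0
  · have := lt_of_lt_thresholdOf (F := F) (γ := γ) (l := thresholdOf γ F - 1) (by omega)
    rw [Nat.cast_sub h] at this
    exact_mod_cast this.le

theorem IsCountCDF.thresholdOf_lt_iff {F : ℤ → ℝ} (hF : IsCountCDF F) {γ : ℝ} (hγ1 : γ ≤ 1)
    {k : ℕ} (hk : 0 < k) : thresholdOf γ F < k ↔ γ ≤ F (k - 1) := by
  constructor
  · intro h
    exact (hF.le_thresholdOf hγ1).trans (hF.mono (by omega))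
  · intro h
    by_contra hlt
    have := lt_of_lt_thresholdOf (F := F) (γ := γ) (l := k - 1) (by omega)
    rw [Nat.cast_sub hk] at this
    exact absurd h (not_le.2 (by exact_mod_cast this))

/-- The opening rule selects exactly the lowest `γ` of the mass of `F`. The truncated form no longer
mentions the threshold, so monotonicity and continuity in `γ` become accessible. -/
theorem IsCountCDF.openProbOf_mul_sub {F : ℤ → ℝ} (hF : IsCountCDF F) {γ : ℝ} (hγ0 : 0 ≤ γ)
    (hγ1 : γ ≤ 1) (l : ℤ) :
    openProbOf γ F l * (F l - F (l - 1)) = min (F l) γ - min (F (l - 1)) γ := by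
  have h1 := hF.le_thresholdOf hγ1
  have h2 := hF.thresholdOf_sub_one_le hγ0
  unfold openProbOf
  split_ifs with h h'
  · have hl : F l ≤ γ := (hF.mono (by omega)).trans h2
    rw [min_eq_left hl, min_eq_left ((hF.mono (by omega)).trans hl), one_mul]
  · rw [h', min_eq_right h1, min_eq_left h2]
    -- If the denominator vanishes, `γ` is squeezed between two equal values, so both sides are zero
    -- whatever the quotient is.
    by_cases h0 : F (thresholdOf γ F) - F (thresholdOf γ F - 1) = 0
    · rw [h0, mul_zero]
      linarith
    · exact div_mul_cancel₀ _ h0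
  · rw [min_eq_right (h1.trans (hF.mono (by omega))),
      min_eq_right (h1.trans (hF.mono (by omega)))]
    ring

theorem IsCountCDF.openProbOf_mem {F : ℤ → ℝ} (hF : IsCountCDF F) {γ : ℝ} (hγ0 : 0 ≤ γ)
    (hγ1 : γ ≤ 1) (l : ℤ) : openProbOf γ F l ∈ Set.Icc (0 : ℝ) 1 := by
  have h1 := hF.le_thresholdOf hγ1
  have h2 := hF.thresholdOf_sub_one_le hγ0
  unfold openProbOf
  split_ifs with h h'
  · simp
  · rw [h']
    exact ⟨div_nonneg (by linarith) (by linarith), div_le_one_of_le₀ (by linarith) (by linarith)⟩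
  · simp

theorem brokenCDF_succ {γ : ℝ} (hγ0 : 0 ≤ γ) (hγ1 : γ ≤ 1) {x : ℕ → ℝ} {i : ℕ}
    (hF : IsCountCDF (brokenCDF γ x i)) (l : ℤ) :
    brokenCDF γ x (i + 1) l = brokenCDF γ x i l -
      x i * (min (brokenCDF γ x i l) γ - min (brokenCDF γ x i (l - 1)) γ) := by
  rw [← hF.openProbOf_mul_sub hγ0 hγ1]
  rw [brokenCDF]
  split_ifs with h
  · ring
  · rw [hF.neg l (by omega), hF.neg (l - 1) (by omega)]
    ring

theorem isCountCDF_brokenCDF {γ : ℝ} (hγ0 : 0 ≤ γ) (hγ1 : γ ≤ 1) {x : ℕ → ℝ} {i : ℕ}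
    (hx : ∀ j < i, x j ∈ Set.Icc (0 : ℝ) 1) : IsCountCDF (brokenCDF γ x i) := by
  induction i with
  | zero =>
    refine ⟨fun a b hab => ?_, fun l hl => ?_, fun l => ?_, ⟨0, by simp [brokenCDF]⟩⟩
    · simp only [brokenCDF]
      split_ifs
      · exact le_rfl
      · omega
      · norm_num
      · norm_num
    · simp [brokenCDF, hl]
    · simp only [brokenCDF]
      split_ifs <;> norm_num
  | succ i ih =>
    have hF := ih fun j hj => hx j (by omega)
    obtain ⟨hx0, hx1⟩ := hx i (by omega)
    have hs := brokenCDF_succ hγ0 hγ1 hF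
    refine ⟨fun a b hab => ?_, fun l hl => ?_, fun l => ?_, ?_⟩
    -- `F l - x i * min (F l) γ` is nondecreasing in `F l` because `x i ≤ 1`; the remaining term `x
    -- i * min (F (l - 1)) γ` is nondecreasing in `l` because `0 ≤ x i`.
    · rw [hs, hs]
      have h1 : min (brokenCDF γ x i (a - 1)) γ ≤ min (brokenCDF γ x i (b - 1)) γ :=
        min_le_min_right _ (hF.mono (by omega))
      have h2 : min (brokenCDF γ x i b) γ - min (brokenCDF γ x i a) γ
          ≤ brokenCDF γ x i b - brokenCDF γ x i a := by
        have := hF.mono hab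
        rcases min_cases (brokenCDF γ x i b) γ with h | h <;>
          rcases min_cases (brokenCDF γ x i a) γ with h' | h' <;> linarith
      have h3 : 0 ≤ min (brokenCDF γ x i b) γ - min (brokenCDF γ x i a) γ :=
        sub_nonneg.2 (min_le_min_right _ (hF.mono hab))
      have h4 := mul_le_mul_of_nonneg_left h1 hx0
      have h5 := mul_le_of_le_one_left h3 hx1
      linarith
    · simp [brokenCDF, hl]
    · rw [hs]
      have h1 : min (brokenCDF γ x i (l - 1)) γ ≤ min (brokenCDF γ x i l) γ :=
        min_le_min_right _ (hF.mono (by omega))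
      have := hF.le_one l
      have := mul_nonneg hx0 (sub_nonneg.2 h1)
      linarith
    · obtain ⟨L, hL⟩ := hF.eq_one
      -- One box breaks at most one wand, so the support grows by at most one.
      refine ⟨L + 1, ?_⟩
      rw [hs]
      push_cast
      have : brokenCDF γ x i ((L : ℤ) + 1) = 1 :=
        le_antisymm (hF.le_one _) (hL.symm.le.trans (hF.mono (by omega)))
      rw [add_sub_cancel_right, this, hL]
      ring

/-- With `a = F l` and `b = F (l - 1)`, the recursion `a - x * (min a γ - min b γ)` is nondecreasing
in `a` and in `b`, and nonincreasing in `γ` since `b ≤ a`. -/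
theorem brokenCDF_anti {γ γ' : ℝ} (hγ0 : 0 ≤ γ) (hγγ' : γ ≤ γ') (hγ1 : γ' ≤ 1) {x : ℕ → ℝ} {i : ℕ}
    (hx : ∀ j < i, x j ∈ Set.Icc (0 : ℝ) 1) (l : ℤ) :
    brokenCDF γ' x i l ≤ brokenCDF γ x i l := by
  induction i generalizing l with
  | zero => simp [brokenCDF]
  | succ i ih =>
    have hx' : ∀ j < i, x j ∈ Set.Icc (0 : ℝ) 1 := fun j hj => hx j (by omega)
    obtain ⟨hx0, hx1⟩ := hx i (by omega)
    have hF := isCountCDF_brokenCDF hγ0 (hγγ'.trans hγ1) hx'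
    have hF' := isCountCDF_brokenCDF (hγ0.trans hγγ') hγ1 hx'
    rw [brokenCDF_succ hγ0 (hγγ'.trans hγ1) hF, brokenCDF_succ (hγ0.trans hγγ') hγ1 hF']
    have ha := ih hx' l
    have hb := ih hx' (l - 1)
    have hab := hF'.mono (show l - 1 ≤ l by omega)
    generalize brokenCDF γ x i l = a at *
    generalize brokenCDF γ x i (l - 1) = b at *
    generalize brokenCDF γ' x i l = a' at *
    generalize brokenCDF γ' x i (l - 1) = b' at *
    have h1 : min a γ - min a' γ ≤ a - a' := by
      rcases min_cases a γ with h | h <;> rcases min_cases a' γ with h' | h' <;> linarith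
    have h2 : min b' γ ≤ min b γ := min_le_min_right _ hb
    have h3 : min a' γ - min b' γ ≤ min a' γ' - min b' γ' := by
      rcases min_cases a' γ with h | h <;> rcases min_cases b' γ with h' | h' <;>
      rcases min_cases a' γ' with h'' | h'' <;> rcases min_cases b' γ' with h''' | h''' <;> linarith
    have h4 : 0 ≤ min a γ - min a' γ := sub_nonneg.2 (min_le_min_right _ ha)
    have h5 := mul_le_of_le_one_left h4 hx1
    have h6 := mul_le_mul_of_nonneg_left h2 hx0
    have h7 := mul_le_mul_of_nonneg_left h3 hx0
    linarith

theorem continuousOn_brokenCDF {x : ℕ → ℝ} {i : ℕ} (hx : ∀ j < i, x j ∈ Set.Icc (0 : ℝ) 1)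
    (l : ℤ) : ContinuousOn (fun γ => brokenCDF γ x i l) (Set.Icc 0 1) := by
  induction i generalizing l with
  | zero => simpa [brokenCDF] using continuousOn_const
  | succ i ih =>
    have hx' : ∀ j < i, x j ∈ Set.Icc (0 : ℝ) 1 := fun j hj => hx j (by omega)
    have h : ContinuousOn (fun γ => brokenCDF γ x i l -
        x i * (min (brokenCDF γ x i l) γ - min (brokenCDF γ x i (l - 1)) γ)) (Set.Icc 0 1) :=
      (ih hx' l).sub (continuousOn_const.mul
        (((ih hx' l).inf continuousOn_id).sub ((ih hx' (l - 1)).inf continuousOn_id)))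
    exact h.congr fun γ hγ => brokenCDF_succ hγ.1 hγ.2 (isCountCDF_brokenCDF hγ.1 hγ.2 hx') l

/-- The supremum is attained: each threshold condition reads `γ ≤ F (k' - 1)`, which is closed
because `F` depends continuously on `γ`, and `0` satisfies all of them. -/
theorem gammaOpt_mem {k : ℕ} (hk : 0 < k) :
    0 ≤ gammaOpt k ∧ gammaOpt k ≤ 1 ∧ ∀ k' : ℕ, k ≤ k' → ∀ (N : ℕ) (x : ℕ → ℝ),
    (∀ i < N, 0 ≤ x i ∧ x i ≤ 1) → ∑ i ∈ Finset.range N, x i ≤ k' →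
      ∀ i < N, threshold (gammaOpt k) x i < k' := by
  let A : Set ℝ := {γ : ℝ | 0 ≤ γ ∧ γ ≤ 1 ∧ ∀ k' : ℕ, k ≤ k' → ∀ (N : ℕ) (x : ℕ → ℝ),
    (∀ i < N, 0 ≤ x i ∧ x i ≤ 1) → ∑ i ∈ Finset.range N, x i ≤ k' →
      ∀ i < N, threshold γ x i < k'}
  have hA : A = Set.Icc 0 1 ∩ ⋂ (k' : ℕ) (_ : k ≤ k') (N : ℕ) (x : ℕ → ℝ)
      (_ : ∀ i < N, 0 ≤ x i ∧ x i ≤ 1) (_ : ∑ i ∈ Finset.range N, x i ≤ k') (i : ℕ) (_ : i < N),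
      {γ ∈ Set.Icc (0 : ℝ) 1 | γ ≤ brokenCDF γ x i (k' - 1)} := by
    ext γ
    simp only [A, Set.mem_ofPred_eq, Set.mem_inter_iff, Set.mem_iInter, Set.mem_Icc]
    constructor
    · rintro ⟨h0, h1, h⟩
      refine ⟨⟨h0, h1⟩, fun k' hk' N x hx hs i hi => ⟨⟨h0, h1⟩, ?_⟩⟩
      exact ((isCountCDF_brokenCDF h0 h1 fun j hj => hx j (by omega)).thresholdOf_lt_iff h1
        (by omega)).1 (h k' hk' N x hx hs i hi)
    · rintro ⟨⟨h0, h1⟩, h⟩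
      refine ⟨h0, h1, fun k' hk' N x hx hs i hi => ?_⟩
      exact ((isCountCDF_brokenCDF h0 h1 fun j hj => hx j (by omega)).thresholdOf_lt_iff h1
        (by omega)).2 (h k' hk' N x hx hs i hi).2
  have hclosed : IsClosed A := by
    rw [hA]
    refine isClosed_Icc.inter ?_
    refine isClosed_iInter fun k' => isClosed_iInter fun _ => isClosed_iInter fun N =>
      isClosed_iInter fun x => isClosed_iInter fun hx => isClosed_iInter fun _ =>
      isClosed_iInter fun i => isClosed_iInter fun hi => ?_
    exact isClosed_Icc.isClosed_le continuousOn_id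
      (continuousOn_brokenCDF (fun j hj => hx j (by omega)) _)
  have h0 : (0 : ℝ) ∈ A := by
    refine ⟨le_rfl, zero_le_one, fun k' hk' N x hx _ i hi => ?_⟩
    have hF := isCountCDF_brokenCDF le_rfl zero_le_one (x := x) (i := i)
      fun j hj => hx j (by omega)
    exact (hF.thresholdOf_lt_iff zero_le_one (by omega)).2 (hF.nonneg _)
  exact hclosed.csSup_mem ⟨0, h0⟩ ⟨1, fun γ hγ => hγ.2.1⟩

theorem threshold_lt_of_le_gammaOpt {k : ℕ} (hk : 0 < k) {γ : ℝ} (hγ0 : 0 ≤ γ)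
    (hγ : γ ≤ gammaOpt k) {k' : ℕ} (hk' : k ≤ k') {N : ℕ} {x : ℕ → ℝ}
    (hx : ∀ i < N, x i ∈ Set.Icc (0 : ℝ) 1) (hs : ∑ i ∈ Finset.range N, x i ≤ k') {i : ℕ}
    (hi : i < N) : threshold γ x i < k' := by
  obtain ⟨h0, h1, h⟩ := gammaOpt_mem hk
  have hx' : ∀ j < i, x j ∈ Set.Icc (0 : ℝ) 1 := fun j hj => hx j (by omega)
  have h2 := ((isCountCDF_brokenCDF h0 h1 hx').thresholdOf_lt_iff h1 (hk.trans_le hk')).1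
    (h k' hk' N x hx hs i hi)
  exact ((isCountCDF_brokenCDF hγ0 (hγ.trans h1) hx').thresholdOf_lt_iff (hγ.trans h1)
    (hk.trans_le hk')).2 (hγ.trans (h2.trans (brokenCDF_anti hγ0 hγ h1 hx' _)))

/-! ## Extended expectations -/

section Expect

variable {Ω Ω' : Type*} [MeasurableSpace Ω] [MeasurableSpace Ω']

/-- No integrability is needed: `⊤ + ⊥ = ⊥` in `EReal` agrees with the convention for `∞ - ∞`, and
addition stays commutative and associative, so positive and negative parts can be regrouped. -/
theorem expect_add_measure (μ ν : Measure Ω) (f : Ω → EReal) :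
    expect (μ + ν) f = expect μ f + expect ν f := by
  unfold expect
  rw [lintegral_add_measure, lintegral_add_measure, EReal.coe_ennreal_add, EReal.coe_ennreal_add,
    sub_eq_add_neg, sub_eq_add_neg, sub_eq_add_neg, EReal.neg_add, sub_eq_add_neg,
    add_add_add_comm]
  · exact Or.inl (EReal.coe_ennreal_ne_bot _)
  · exact Or.inr (EReal.coe_ennreal_ne_bot _)

theorem expect_smul_measure {c : ℝ≥0∞} (hc : c ≠ ∞) (μ : Measure Ω) (f : Ω → EReal) :
    expect (c • μ) f = (c : EReal) * expect μ f := by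
  unfold expect
  rw [lintegral_smul_measure, lintegral_smul_measure, smul_eq_mul, smul_eq_mul,
    EReal.coe_ennreal_mul, EReal.coe_ennreal_mul, sub_eq_add_neg, sub_eq_add_neg,
    EReal.left_distrib_of_nonneg_of_ne_top (EReal.coe_ennreal_nonneg _)
      (by simpa using hc), mul_neg]

theorem expect_sum_smul_measure {S : Type*} (A : Finset S) {c : S → ℝ≥0∞} (hc : ∀ s, c s ≠ ∞)
    (μ : S → Measure Ω) (f : Ω → EReal) :
    expect (∑ s ∈ A, c s • μ s) f = ∑ s ∈ A, (c s : EReal) * expect (μ s) f := by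
  classical
  induction A using Finset.induction_on with
  | empty => simp [expect]
  | insert a A ha ih =>
    rw [Finset.sum_insert ha, Finset.sum_insert ha, expect_add_measure,
      expect_smul_measure (hc a), ih]

theorem expect_map {μ : Measure Ω} {g : Ω → Ω'} (hg : Measurable g) {f : Ω' → EReal}
    (hf : Measurable f) : expect (μ.map g) f = expect μ fun a => f (g a) := by
  unfold expect
  rw [lintegral_map hf.ereal_toENNReal hg, lintegral_map (f := fun a => (-f a).toENNReal) hf.neg.ereal_toENNReal hg]

end Expect

/-! ## The sequential process -/

theorem induced_mem_cube {ι : Type*} [DecidableEq ι] {x : ι → ℝ} (hx : x ∈ cube ι) (S : Finset ι) : induced x S ∈ cube ι := by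
  refine ⟨fun j => ?_, fun j => ?_⟩
  · unfold induced
    split_ifs
    · exact hx.1 j
    · exact le_rfl
  · unfold induced
    split_ifs
    · exact hx.2 j
    · exact zero_le_one

section Sequential

variable {n : ℕ} {ι : Type*} [Fintype ι] [DecidableEq ι] {T : Fin n → Type*}
  [∀ i, MeasurableSpace (T i)]

/-- `x[S]` for the set `S` with indicator `s`. -/
def offered (x : ι → ℝ) (s : ι → Bool) : ι → ℝ :=
  induced x (Finset.univ.filter fun j => s j = true)

theorem offered_apply (x : ι → ℝ) (s : ι → Bool) (j : ι) :
    offered x s j = if s j = true then x j else 0 := by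
  simp [offered, induced]

theorem offered_mem_cube {x : ι → ℝ} (hx : x ∈ cube ι) (s : ι → Bool) : offered x s ∈ cube ι :=
  induced_mem_cube hx _

variable (γ : ℝ) (x : Fin n → ι → ℝ) (mech : ∀ i, (ι → ℝ) → Mech (T i) (Outcome ι))

theorem measurable_record_right (i : Fin n) (q : State n ι) : Measurable fun o => record i q o :=
  (measurable_record i).comp measurable_prodMk_left

theorem lintegral_serve (i : Fin n) (z : (∀ i, T i) × State n ι) {f : State n ι → ℝ≥0∞}
    (hf : Measurable f) :
    ∫⁻ q, f q ∂(serve γ x mech i z) =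
      ∫⁻ s, ∫⁻ o, f (record i z.2 o) ∂(mech i (offered (x i) s)).1 (z.1 i)
        ∂(openLaw γ x i z.2.1) := by
  have hr : Measurable fun z : ((∀ i, T i) × State n ι) × ((ι → Bool) × Outcome ι) =>
      record i z.1.2 z.2.2 := (measurable_record i).comp
    (f := fun z : ((∀ i, T i) × State n ι) × ((ι → Bool) × Outcome ι) => (z.1.2, z.2.2))
    (by fun_prop)
  have hfr : Measurable fun z : ((∀ i, T i) × State n ι) × ((ι → Bool) × Outcome ι) =>
      f (record i z.1.2 z.2.2) := hf.comp hr
  unfold serve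
  rw [Kernel.lintegral_map _ hr _ hf, Kernel.lintegral_id_prod hfr,
    Kernel.lintegral_compProd _ _ _ (f := fun b => f (record i z.2 b.2))
      (hfr.comp measurable_prodMk_left)]
  rfl

theorem lintegral_stateAfter_succ (i : Fin n) (θ : ∀ i, T i) {f : State n ι → ℝ≥0∞}
    (hf : Measurable f) :
    ∫⁻ q, f q ∂(stateAfter γ x mech (i + 1) θ) =
      ∫⁻ q, ∫⁻ s, ∫⁻ o, f (record i q o) ∂(mech i (offered (x i) s)).1 (θ i)
        ∂(openLaw γ x i q.1) ∂(stateAfter γ x mech i θ) := by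
  rw [stateAfter, dif_pos i.2, Kernel.lintegral_comp _ _ _ hf,
    Kernel.lintegral_id_prod (Measurable.lintegral_kernel hf)]
  exact lintegral_congr fun q => lintegral_serve γ x mech i (θ, q) hf

/-- Serving buyer `a` reads only the report of `a`, and the first `r` buyers all precede `i`. -/
theorem stateAfter_update {r : ℕ} (i : Fin n) (hr : r ≤ i) (θ : ∀ i, T i) (t : T i) :
    stateAfter γ x mech r (Function.update θ i t) = stateAfter γ x mech r θ := by
  induction r with
  | zero => simp [stateAfter]
  | succ r ih =>
    have hrn : r < n := by omega
    refine Measure.ext_of_lintegral _ fun f hf => ?_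
    have h1 := lintegral_stateAfter_succ γ x mech ⟨r, hrn⟩ (Function.update θ i t) hf
    have h2 := lintegral_stateAfter_succ γ x mech ⟨r, hrn⟩ θ hf
    simp only [] at h1 h2
    rw [h1, h2, ih (by omega), Function.update_of_ne]
    exact fun h => by simp [← h] at hr

/-- The law of the (indicator of the) set of items that are offered to buyer `i`. -/
noncomputable def offerLaw (i : Fin n) : Kernel (∀ i, T i) (ι → Bool) :=
  openLaw γ x i ∘ₖ (stateAfter γ x mech i).map Prod.fst

instance (i : Fin n) : IsMarkovKernel (offerLaw γ x mech i) := by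
  have : IsMarkovKernel ((stateAfter γ x mech i).map Prod.fst) :=
    Kernel.IsMarkovKernel.map _ measurable_fst
  unfold offerLaw
  infer_instance

theorem lintegral_offerLaw (i : Fin n) (θ : ∀ i, T i) (f : (ι → Bool) → ℝ≥0∞) :
    ∫⁻ s, f s ∂(offerLaw γ x mech i θ) =
      ∫⁻ q, ∫⁻ s, f s ∂(openLaw γ x i q.1) ∂(stateAfter γ x mech i θ) := by
  have hf : Measurable f := measurable_of_countable f
  rw [offerLaw, Kernel.lintegral_comp _ _ _ hf,
    Kernel.lintegral_map _ measurable_fst _ (Measurable.lintegral_kernel hf)]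

theorem offerLaw_update (i : Fin n) (θ : ∀ i, T i) (t : T i) :
    offerLaw γ x mech i (Function.update θ i t) = offerLaw γ x mech i θ := by
  refine Measure.ext_of_lintegral _ fun f hf => ?_
  rw [lintegral_offerLaw, lintegral_offerLaw, stateAfter_update γ x mech i le_rfl]

/-- Serving later buyers overwrites other coordinates only, so the recorded outcome of buyer `i` is
frozen once she is served. -/
theorem lintegral_outcome_stateAfter (i : Fin n) (θ : ∀ i, T i) {r : ℕ} (hr : i + 1 ≤ r)
    (hrn : r ≤ n) {f : Outcome ι → ℝ≥0∞} (hf : Measurable f) :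
    ∫⁻ q, f (q.2 i) ∂(stateAfter γ x mech r θ) =
      ∫⁻ s, ∫⁻ o, f o ∂(mech i (offered (x i) s)).1 (θ i) ∂(offerLaw γ x mech i θ) := by
  induction r, hr using Nat.le_induction with
  | base =>
    rw [lintegral_stateAfter_succ γ x mech i θ (f := fun q => f (q.2 i)) (by fun_prop),
      lintegral_offerLaw]
    simp [record]
  | succ r hr ih =>
    have h := lintegral_stateAfter_succ γ x mech ⟨r, hrn⟩ θ (f := fun q => f (q.2 i)) (by fun_prop)
    have hne : i ≠ ⟨r, hrn⟩ := fun h => by simp [h] at hr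
    rw [← ih (by omega)]
    simpa [record, Function.update_of_ne hne] using h

theorem map_preRounding (i : Fin n) (θ : ∀ i, T i) :
    ((preRounding γ x mech).1 θ).map (fun o => o i) =
      ∑ s, offerLaw γ x mech i θ {s} • (mech i (offered (x i) s)).1 (θ i) := by
  refine Measure.ext_of_lintegral _ fun f hf => ?_
  rw [lintegral_map hf (measurable_pi_apply i), preRounding,
    Kernel.lintegral_map _ measurable_snd _ (by fun_prop),
    lintegral_outcome_stateAfter γ x mech i θ i.2 le_rfl hf, lintegral_fintype,
    lintegral_finsetSum_measure]
  simp [lintegral_smul_measure, mul_comm]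

theorem expect_preRounding (i : Fin n) (θ : ∀ i, T i) {f : Outcome ι → EReal} (hf : Measurable f) :
    expect ((preRounding γ x mech).1 θ) (fun o => f (o i)) =
      ∑ s, (offerLaw γ x mech i θ {s} : EReal) *
        expect ((mech i (offered (x i) s)).1 (θ i)) f := by
  rw [← expect_map (measurable_pi_apply i) hf, map_preRounding,
    expect_sum_smul_measure _ fun s => measure_ne_top _ _]

theorem isDSIC_preRounding {util : ∀ i, T i → Outcome ι → EReal}
    (hutil : ∀ i t, Measurable (util i t)) (hx : ∀ i, x i ∈ cube ι)
    (hIC : ∀ i, ∀ x ∈ cube ι, IsIC (util i) (mech i x)) :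
    IsDSIC util (preRounding γ x mech) := by
  intro i θ t'
  rw [expect_preRounding γ x mech i _ (hutil i _), expect_preRounding γ x mech i _ (hutil i _),
    offerLaw_update, Function.update_self]
  -- A misreport leaves the weights unchanged, so the mixtures are compared term by term.
  exact Finset.sum_le_sum fun s _ => mul_le_mul_of_nonneg_left
    (hIC i _ (offered_mem_cube (hx i) s) _ _) (EReal.coe_ennreal_nonneg _)

end Sequential

/-! ### Averages over the types -/

section Average

variable {n : ℕ} {ι : Type*} {T : Fin n → Type*} [∀ i, MeasurableSpace (T i)]
  (D : ∀ i, Measure (T i)) [∀ i, IsProbabilityMeasure (D i)]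

theorem measurable_update_pair (i : Fin n) :
    Measurable (fun p : T i × (∀ i, T i) => Function.update p.2 i p.1) := by
  rw [measurable_pi_iff]
  intro a
  by_cases h : a = i
  · subst h
    simpa using measurable_fst
  · simp only [Function.update_of_ne h]
    exact (measurable_pi_apply a).comp measurable_snd

/-- Resampling one coordinate preserves a product measure. This is how independence of the types
enters. -/
theorem map_update_prod_pi (i : Fin n) :
    ((D i).prod (Measure.pi D)).map (fun p : T i × (∀ i, T i) => Function.update p.2 i p.1) =
      Measure.pi D := by
  symm
  refine Measure.pi_eq fun s hs => ?_
  have : (fun p : T i × (∀ i, T i) => Function.update p.2 i p.1) ⁻¹' (Set.univ.pi s) =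
      s i ×ˢ (Set.univ.pi (Function.update s i Set.univ)) := by
    ext p
    simp only [Set.mem_preimage, Set.mem_pi, Set.mem_univ, true_implies, Set.mem_prod]
    constructor
    · intro h
      refine ⟨by simpa using h i, fun a => ?_⟩
      by_cases ha : a = i
      · subst ha; simp
      · simpa [Function.update_of_ne ha] using h a
    · rintro ⟨h1, h2⟩ a
      by_cases ha : a = i
      · subst ha; simpa using h1
      · simpa [Function.update_of_ne ha] using h2 a
  rw [Measure.map_apply (measurable_update_pair i) (MeasurableSet.univ_pi hs), this,
    Measure.prod_prod, Measure.pi_pi, ← Finset.mul_prod_erase _ _ (Finset.mem_univ i),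
    ← Finset.mul_prod_erase Finset.univ (fun a => D a (s a)) (Finset.mem_univ i)]
  simp only [Function.update_self, measure_univ, one_mul]
  congr 1
  exact Finset.prod_congr rfl fun a ha => by rw [Function.update_of_ne (Finset.ne_of_mem_erase ha)]

theorem lintegral_pi_eq_lintegral_update (i : Fin n) {f : (∀ i, T i) → ℝ≥0∞} (hf : Measurable f) :
    ∫⁻ θ, f θ ∂Measure.pi D = ∫⁻ t, ∫⁻ θ, f (Function.update θ i t) ∂Measure.pi D ∂D i := by
  conv_lhs => rw [← map_update_prod_pi D i, lintegral_map hf (measurable_update_pair i)]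
  exact lintegral_prod _ (hf.comp (measurable_update_pair i)).aemeasurable

theorem lintegral_inducedMech (i : Fin n) (M : Mech (∀ i, T i) (Fin n → Outcome ι)) (t : T i)
    {f : Outcome ι → ℝ≥0∞} (hf : Measurable f) :
    ∫⁻ o, f o ∂(inducedMech D i M).1 t =
      ∫⁻ θ, ∫⁻ o, f (o i) ∂M.1 (Function.update θ i t) ∂Measure.pi D := by
  have hf' : Measurable fun o : Fin n → Outcome ι => f (o i) := by fun_prop
  have hM : Measurable fun θ => ∫⁻ o, f (o i) ∂M.1 θ := Measurable.lintegral_kernel hf'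
  have hMu : Measurable fun p : T i × (∀ i, T i) =>
      ∫⁻ o, f (o i) ∂M.1 (Function.update p.2 i p.1) := hM.comp (measurable_update_pair i)
  unfold inducedMech
  rw [Kernel.lintegral_map _ (measurable_pi_apply i) _ hf, Kernel.lintegral_comp _ _ _ hf',
    Kernel.lintegral_map _ (measurable_update_pair i) _ hM,
    Kernel.lintegral_id_prod hMu, Kernel.const_apply]

/-- It allows value and ex ante allocation of one buyer to be computed from her perceived mechanism
alone. -/
theorem map_pi_compProd (i : Fin n) (M : Mech (∀ i, T i) (Fin n → Outcome ι)) :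
    (Measure.pi D ⊗ₘ M.1).map (fun z => (z.1 i, z.2 i)) = D i ⊗ₘ (inducedMech D i M).1 := by
  refine Measure.ext_of_lintegral _ fun f hf => ?_
  have h1 : Measurable fun z : (∀ i, T i) × (Fin n → Outcome ι) => (z.1 i, z.2 i) := by fun_prop
  have hf1 : Measurable fun z : (∀ i, T i) × (Fin n → Outcome ι) => f (z.1 i, z.2 i) := hf.comp h1
  rw [lintegral_map hf h1, Measure.lintegral_compProd hf1, Measure.lintegral_compProd hf,
    lintegral_pi_eq_lintegral_update D i]
  · refine lintegral_congr fun t => ?_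
    rw [lintegral_inducedMech D i M t (f := fun o => f (t, o)) (hf.comp measurable_prodMk_left)]
    simp
  · exact hf1.lintegral_kernel_prod_right'

theorem expect_pi_compProd (i : Fin n) (M : Mech (∀ i, T i) (Fin n → Outcome ι))
    {obj : T i → Outcome ι → ℝ} (hobj : Measurable fun z : T i × Outcome ι => obj z.1 z.2) :
    expect (Measure.pi D ⊗ₘ M.1) (fun z => (obj (z.1 i) (z.2 i) : EReal)) =
      singleValue (D i) obj (inducedMech D i M) := by
  have h1 : Measurable fun z : (∀ i, T i) × (Fin n → Outcome ι) => (z.1 i, z.2 i) := by fun_prop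
  rw [singleValue, ← map_pi_compProd, expect_map h1 hobj.coe_real_ereal]

end Average

/-! ## Supply constraints -/

section Supply

variable {n : ℕ} {ι : Type*} [Fintype ι] {T : Fin n → Type*}
  [∀ i, MeasurableSpace (T i)]
  (γ : ℝ) (x : Fin n → ι → ℝ) (mech : ∀ i, (ι → ℝ) → Mech (T i) (Outcome ι))

theorem openLaw_apply_setOf (i : Fin n) (w : ι → ℕ) (j : ι)
    (hp : openProb γ (boxes x j) i (w j) ∈ Set.Icc (0 : ℝ) 1) :
    openLaw γ x i w {s | s j = true} = ENNReal.ofReal (openProb γ (boxes x j) i (w j)) := by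
  have h : {s : ι → Bool | s j = true} = (fun s => s j) ⁻¹' {true} := rfl
  change Measure.pi _ _ = _
  rw [h, ← Measure.map_apply (measurable_pi_apply j) (measurableSet_singleton _),
    (measurePreserving_eval _ j).map_eq,
    bernoulliMeasure_apply_of_mem_of_notMem _ (measurableSet_singleton _) rfl
      (fun h => Bool.false_ne_true h), Set.projIcc_of_mem _ hp]
  exact (ENNReal.ofReal_eq_coe_nnreal hp.1).symm

/-- The number of broken wands equals the number of allocated units and respects the supply, and
buyers from `r` on have not got anything. -/
def IsConsistent (k : ι → ℕ) (r : ℕ) (q : State n ι) : Prop :=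
  ∀ j, (Finset.univ.filter fun a => (q.2 a).1 j = true).card = q.1 j ∧ q.1 j ≤ k j ∧
    ∀ a : Fin n, r ≤ a → (q.2 a).1 j = false

theorem measurable_card_allocated {ι : Type*} (j : ι) : Measurable fun o : Fin n → Outcome ι =>
    (Finset.univ.filter fun a => (o a).1 j = true).card := by
  simp only [Finset.card_filter]
  exact Finset.measurable_fun_sum _ fun a _ =>
    (measurable_of_countable fun b : Bool => if b = true then 1 else 0).comp
      (f := fun o : Fin n → Outcome ι => (o a).1 j) (by fun_prop)

theorem measurableSet_isConsistent (k : ι → ℕ) (r : ℕ) :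
    MeasurableSet {q : State n ι | IsConsistent k r q} := by
  have hout : ∀ (a : Fin n) (j : ι), Measurable fun q : State n ι => (q.2 a).1 j := by
    intro a j
    fun_prop
  have hw : ∀ j : ι, Measurable fun q : State n ι => q.1 j := by
    intro j
    fun_prop
  have hcard : ∀ j : ι, Measurable fun q : State n ι =>
      (Finset.univ.filter fun a => (q.2 a).1 j = true).card := fun j =>
    (measurable_card_allocated j).comp measurable_snd
  have h : {q : State n ι | IsConsistent k r q} =
      ⋂ j, {q | (Finset.univ.filter fun a => (q.2 a).1 j = true).card = q.1 j} ∩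
        ({q | q.1 j ≤ k j} ∩ ⋂ (a : Fin n) (_ : r ≤ a), {q | (q.2 a).1 j = false}) := by
    ext q
    simp [IsConsistent]
  rw [h]
  exact MeasurableSet.iInter fun j => (measurableSet_eq_fun (hcard j) (hw j)).inter
    ((measurableSet_le (hw j) measurable_const).inter <| MeasurableSet.iInter fun a =>
      MeasurableSet.iInter fun _ => measurableSet_eq_fun (hout a j) measurable_const)

/-- Above the threshold the opening probability is zero. With thresholds below the supply, every
item actually offered has a unit left. -/
theorem lt_of_openLaw_ne_zero (i : Fin n) (w : ι → ℕ) (s : ι → Bool)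
    (hs : openLaw γ x i w {s} ≠ 0) {j : ι} (hj : s j = true)
    (hp : openProb γ (boxes x j) i (w j) ∈ Set.Icc (0 : ℝ) 1) :
    w j ≤ threshold γ (boxes x j) i := by
  have h1 : openLaw γ x i w {s} ≤ openLaw γ x i w {s | s j = true} :=
    measure_mono (Set.singleton_subset_iff.2 hj)
  rw [openLaw_apply_setOf γ x i w j hp] at h1
  by_contra! hlt
  refine hs (le_antisymm (h1.trans ?_) zero_le)
  rw [openProb, openProbOf, if_neg (by unfold threshold at hlt; omega),
    if_neg (by unfold threshold at hlt; omega), ENNReal.ofReal_zero]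

theorem IsConsistent.record {ι : Type*} {k : ι → ℕ} {i : Fin n} {q : State n ι} (hq : IsConsistent k i q)
    {o : Outcome ι} (ho : ∀ j, o.1 j = true → q.1 j < k j) :
    IsConsistent k (i + 1) (record i q o) := by
  intro j
  obtain ⟨h1, h2, h3⟩ := hq j
  have hi : (q.2 i).1 j = false := h3 i le_rfl
  have hsum : ∑ a ∈ Finset.univ.erase i, (if (Function.update q.2 i o a).1 j = true then 1 else 0)
      = ∑ a ∈ Finset.univ.erase i, (if (q.2 a).1 j = true then 1 else 0) :=
    Finset.sum_congr rfl fun a ha => by rw [Function.update_of_ne (Finset.ne_of_mem_erase ha)]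
  refine ⟨?_, ?_, fun a ha => ?_⟩
  · change (Finset.univ.filter fun a => (Function.update q.2 i o a).1 j = true).card =
      q.1 j + if o.1 j = true then 1 else 0
    rw [← h1, Finset.card_filter, Finset.card_filter, ← Finset.add_sum_erase _ _ (Finset.mem_univ i), hsum,
      ← Finset.add_sum_erase Finset.univ (fun a => if (q.2 a).1 j = true then 1 else 0)
        (Finset.mem_univ i)]
    simp [hi, add_comm]
  · simp only [Auction.record]
    split_ifs with hj
    · exact ho j hj
    · exact h2
  · have hne : a ≠ i := fun h => by simp [h] at ha
    simp only [Auction.record, Function.update_of_ne hne]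
    exact h3 a (by omega)

variable [DecidableEq ι]

/-- Invariants need to be checked only for sets `s` that are offered with positive probability, the
only ones for which the threshold gives information. -/
theorem ae_stateAfter_succ (i : Fin n) (θ : ∀ i, T i) {p : State n ι → Prop}
    (hp : MeasurableSet {q | p q})
    (h : ∀ᵐ q ∂(stateAfter γ x mech i θ), ∀ s, openLaw γ x i q.1 {s} ≠ 0 →
      ∀ᵐ o ∂((mech i (offered (x i) s)).1 (θ i)), p (record i q o)) :
    ∀ᵐ q ∂(stateAfter γ x mech (i + 1) θ), p q := by
  have hm : MeasurableSet {q | ¬ p q} := hp.compl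
  rw [ae_iff, ← lintegral_indicator_one hm,
    lintegral_stateAfter_succ γ x mech i θ (measurable_one.indicator hm)]
  refine lintegral_eq_zero_of_ae_eq_zero ?_
  filter_upwards [h] with q hq
  rw [lintegral_fintype]
  refine Finset.sum_eq_zero fun s _ => ?_
  by_cases hs : openLaw γ x i q.1 {s} = 0
  · rw [hs, mul_zero]
  · refine mul_eq_zero_of_left (lintegral_eq_zero_of_ae_eq_zero ?_) _
    filter_upwards [hq s hs] with o ho
    simp [ho]

theorem ae_isConsistent (k : ι → ℕ)
    (hp : ∀ (i : Fin n) (j : ι) (w : ℕ), openProb γ (boxes x j) i w ∈ Set.Icc (0 : ℝ) 1)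
    (hk : ∀ (i : Fin n) (j : ι), threshold γ (boxes x j) i < k j)
    (hx : ∀ i, x i ∈ cube ι)
    (hzero : ∀ i, ∀ x ∈ cube ι, ∀ j, x j = 0 →
      ∀ t, ∀ᵐ o ∂((mech i x).1 t), o.1 j = false) (θ : ∀ i, T i) {r : ℕ} (hr : r ≤ n) :
    ∀ᵐ q ∂(stateAfter γ x mech r θ), IsConsistent k r q := by
  induction r with
  | zero =>
    simp only [stateAfter, Kernel.const_apply]
    rw [ae_dirac_iff (measurableSet_isConsistent k 0)]
    intro j
    simp
  | succ r ih =>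
    refine ae_stateAfter_succ γ x mech ⟨r, hr⟩ θ (measurableSet_isConsistent k (r + 1)) ?_
    filter_upwards [ih (by omega)] with q hq s hs
    -- Items outside `s` have bound zero in `offered`, so only items whose box was opened can be
    -- allocated.
    have hall : ∀ᵐ o ∂((mech ⟨r, hr⟩ (offered (x ⟨r, hr⟩) s)).1 (θ ⟨r, hr⟩)),
        ∀ j, s j = false → o.1 j = false := by
      rw [ae_all_iff]
      intro j
      by_cases hj : s j = false
      · filter_upwards [hzero ⟨r, hr⟩ _ (offered_mem_cube (hx _) s) j
          (by simp [offered_apply, hj]) (θ ⟨r, hr⟩)] with o ho _ using ho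
      · exact .of_forall fun o h => absurd h hj
    filter_upwards [hall] with o ho
    refine IsConsistent.record (i := ⟨r, hr⟩) hq fun j hj => ?_
    have hsj : s j = true := by
      by_contra hne
      simp [ho j (by simpa using hne)] at hj
    exact (lt_of_openLaw_ne_zero γ x _ _ s hs hsj (hp _ _ _)).trans_lt (hk _ _)

theorem supply_preRounding (k : ι → ℕ)
    (hp : ∀ (i : Fin n) (j : ι) (w : ℕ), openProb γ (boxes x j) i w ∈ Set.Icc (0 : ℝ) 1)
    (hk : ∀ (i : Fin n) (j : ι), threshold γ (boxes x j) i < k j)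
    (hx : ∀ i, x i ∈ cube ι)
    (hzero : ∀ i, ∀ x ∈ cube ι, ∀ j, x j = 0 →
      ∀ t, ∀ᵐ o ∂((mech i x).1 t), o.1 j = false) :
    Supply k (preRounding γ x mech) := by
  intro θ
  have h := ae_isConsistent γ x mech k hp hk hx hzero θ le_rfl
  unfold preRounding
  simp only [Kernel.map_apply _ measurable_snd]
  rw [ae_map_iff measurable_snd.aemeasurable]
  · filter_upwards [h] with q hq j
    exact (hq j).1.trans_le (hq j).2.1
  · have : {o : Fin n → Outcome ι | ∀ j, (Finset.univ.filter fun i => (o i).1 j = true).card ≤ k j} =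
        ⋂ j, {o | (Finset.univ.filter fun i => (o i).1 j = true).card ≤ k j} := by
      ext o
      simp
    rw [this]
    exact MeasurableSet.iInter fun j =>
      measurableSet_le (measurable_card_allocated j) measurable_const

end Supply

/-! ## Lower bounds on the probabilities of being offered an item -/

theorem bind_apply_allocated {ι X : Type*} [MeasurableSpace X] (D : Measure X) [IsFiniteMeasure D]
    (N : Mech X (Outcome ι)) (j : ι) :
    (N.1 ∘ₘ D) {o | o.1 j = true} = ENNReal.ofReal (exAnte D N j) := by
  rw [exAnte, ofReal_measureReal, ← Measure.snd_compProd, Measure.snd_apply]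
  · rfl
  · exact measurableSet_eq_fun (f := fun o : Outcome ι => o.1 j) (by fun_prop) measurable_const

section Average

variable {n : ℕ} {ι : Type*} [Fintype ι] [DecidableEq ι] {T : Fin n → Type*}
  [∀ i, MeasurableSpace (T i)]
  (γ : ℝ) (x : Fin n → ι → ℝ) (mech : ∀ i, (ι → ℝ) → Mech (T i) (Outcome ι))
  (D : ∀ i, Measure (T i)) [∀ i, IsProbabilityMeasure (D i)]

/-- The state before buyer `i` is independent of her type. After averaging over the types, the state
is thus a Markov chain in which her outcome has the ex ante law `(mech i _).1 ∘ₘ D i`. -/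
theorem lintegral_bind_stateAfter_succ (i : Fin n) {f : State n ι → ℝ≥0∞} (hf : Measurable f) :
    ∫⁻ q, f q ∂(stateAfter γ x mech (i + 1) ∘ₘ Measure.pi D) =
      ∫⁻ q, ∫⁻ s, ∫⁻ o, f (record i q o) ∂((mech i (offered (x i) s)).1 ∘ₘ D i)
        ∂(openLaw γ x i q.1) ∂(stateAfter γ x mech i ∘ₘ Measure.pi D) := by
  let Φ : T i × State n ι → ℝ≥0∞ := fun z => ∑ s,
    (∫⁻ o, f (record i z.2 o) ∂(mech i (offered (x i) s)).1 z.1) * openLaw γ x i z.2.1 {s}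
  have hin : ∀ s, Measurable fun z : T i × State n ι =>
      ∫⁻ o, f (record i z.2 o) ∂(mech i (offered (x i) s)).1 z.1 := by
    intro s
    have h1 : Measurable fun p : (T i × State n ι) × Outcome ι => f (record i p.1.2 p.2) :=
      hf.comp ((measurable_record i).comp
        (f := fun p : (T i × State n ι) × Outcome ι => (p.1.2, p.2)) (by fun_prop))
    exact h1.lintegral_kernel_prod_right'
      (κ := (mech i (offered (x i) s)).1.comap (fun z : T i × State n ι => z.1) measurable_fst)
  have hopen : ∀ s, Measurable fun z : T i × State n ι => openLaw γ x i z.2.1 {s} := fun s =>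
    ((openLaw γ x i).measurable_coe (measurableSet_singleton s)).comp
      (measurable_fst.comp measurable_snd)
  have hΦ : Measurable Φ := Finset.measurable_fun_sum _ fun s _ => (hin s).mul (hopen s)
  have hΦ' : ∀ θ t, ∫⁻ q, f q ∂(stateAfter γ x mech (i + 1) (Function.update θ i t)) =
      ∫⁻ q, Φ (t, q) ∂(stateAfter γ x mech i θ) := by
    intro θ t
    rw [lintegral_stateAfter_succ γ x mech i _ hf, stateAfter_update γ x mech i le_rfl,
      Function.update_self]
    exact lintegral_congr fun q => lintegral_fintype _
  rw [Measure.lintegral_bind (Kernel.aemeasurable _) hf.aemeasurable,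
    lintegral_pi_eq_lintegral_update D i (Measurable.lintegral_kernel hf)]
  simp_rw [hΦ']
  have hswap : ∀ t, ∫⁻ θ, ∫⁻ q, Φ (t, q) ∂(stateAfter γ x mech i θ) ∂Measure.pi D =
      ∫⁻ q, Φ (t, q) ∂(stateAfter γ x mech i ∘ₘ Measure.pi D) := fun t =>
    (Measure.lintegral_bind (f := fun q => Φ (t, q)) (Kernel.aemeasurable _)
      (hΦ.comp measurable_prodMk_left).aemeasurable).symm
  simp_rw [hswap]
  rw [lintegral_lintegral_swap hΦ.aemeasurable]
  refine lintegral_congr fun q => ?_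
  simp only [Φ]
  rw [lintegral_finsetSum, lintegral_fintype]
  · refine Finset.sum_congr rfl fun s _ => ?_
    rw [lintegral_mul_const, Measure.lintegral_bind (Kernel.aemeasurable _)]
    · exact (hf.comp (measurable_record_right i q)).aemeasurable
    · exact (hin s).comp (measurable_prodMk_right (y := q))
  · intro s _
    exact ((hin s).mul (hopen s)).comp (measurable_prodMk_right (y := q))

/-- Only a state with exactly `l` broken wands can leave the event, with probability at most that of
opening the box times `x i j`. Only the marginal law of opening box `j` enters, not its correlation
with other boxes. -/
theorem bind_stateAfter_le (i : Fin n) (j : ι)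
    (hp : ∀ w : ℕ, openProb γ (boxes x j) i w ∈ Set.Icc (0 : ℝ) 1)
    (hE : ∀ s, exAnte (D i) (mech i (offered (x i) s)) j ≤ offered (x i) s j) (l : ℕ) :
    (stateAfter γ x mech i ∘ₘ Measure.pi D) {q | q.1 j ≤ l} ≤
      (stateAfter γ x mech (i + 1) ∘ₘ Measure.pi D) {q | q.1 j ≤ l} +
        ENNReal.ofReal (openProb γ (boxes x j) i l * x i j) *
          (stateAfter γ x mech i ∘ₘ Measure.pi D) {q | q.1 j = l} := by
  have hm : MeasurableSet {q : State n ι | q.1 j ≤ l} :=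
    measurableSet_le (f := fun q : State n ι => q.1 j) (by fun_prop) measurable_const
  have hm' : MeasurableSet {q : State n ι | q.1 j = l} :=
    measurableSet_eq_fun (f := fun q : State n ι => q.1 j) (by fun_prop) measurable_const
  have hmo : MeasurableSet {o : Outcome ι | o.1 j = true} :=
    measurableSet_eq_fun (f := fun o : Outcome ι => o.1 j) (by fun_prop) measurable_const
  rw [← lintegral_indicator_one hm, ← lintegral_indicator_one hm, ← lintegral_indicator_one hm',
    lintegral_bind_stateAfter_succ γ x mech D i (measurable_one.indicator hm),
    ← lintegral_const_mul _ (measurable_one.indicator hm'),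
    ← lintegral_add_right _ ((measurable_one.indicator hm').const_mul _)]
  refine lintegral_mono fun q => ?_
  rcases lt_trichotomy (q.1 j) l with h | h | h
  · have h1 : ∀ o, Set.indicator {q : State n ι | q.1 j ≤ l} (1 : State n ι → ℝ≥0∞)
        (record i q o) = 1 := by
      intro o
      refine Set.indicator_of_mem ?_ _
      change q.1 j + _ ≤ l
      split_ifs <;> omega
    simp only [h1, lintegral_one, measure_univ]
    exact (Set.indicator_le_self' (fun _ _ => zero_le_one) q).trans le_self_add
  · have h1 : ∀ o, Set.indicator {q : State n ι | q.1 j ≤ l} (1 : State n ι → ℝ≥0∞)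
        (record i q o) = Set.indicator {o : Outcome ι | o.1 j = true}ᶜ 1 o := by
      intro o
      by_cases ho : o.1 j = true
      · simp [record, ho, h]
      · simp [record, ho, h]
    simp only [h1]
    have h2 : ∀ s, ∫⁻ o, Set.indicator {o : Outcome ι | o.1 j = true} 1 o
        ∂((mech i (offered (x i) s)).1 ∘ₘ D i) ≤
          ENNReal.ofReal (x i j) * Set.indicator {s : ι → Bool | s j = true} 1 s := by
      intro s
      rw [lintegral_indicator_one hmo, bind_apply_allocated]
      refine (ENNReal.ofReal_le_ofReal (hE s)).trans ?_
      rw [offered_apply]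
      by_cases hs : s j = true <;> simp [hs]
    have h3 : ∫⁻ s, ∫⁻ o, Set.indicator {o : Outcome ι | o.1 j = true} 1 o
        ∂((mech i (offered (x i) s)).1 ∘ₘ D i) ∂(openLaw γ x i q.1) ≤
          ENNReal.ofReal (openProb γ (boxes x j) i l * x i j) := by
      refine (lintegral_mono h2).trans ?_
      rw [lintegral_const_mul _ (measurable_of_countable _),
        lintegral_indicator_one (Set.toFinite _).measurableSet,
        openLaw_apply_setOf γ x i q.1 j (hp _), h, ENNReal.ofReal_mul (hp l).1, mul_comm]
    have h4 : (1 : ℝ≥0∞) = ∫⁻ s, ∫⁻ o, Set.indicator {o : Outcome ι | o.1 j = true}ᶜ 1 o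
        ∂((mech i (offered (x i) s)).1 ∘ₘ D i) ∂(openLaw γ x i q.1) +
        ∫⁻ s, ∫⁻ o, Set.indicator {o : Outcome ι | o.1 j = true} 1 o
        ∂((mech i (offered (x i) s)).1 ∘ₘ D i) ∂(openLaw γ x i q.1) := by
      rw [← lintegral_add_left (measurable_of_countable _)]
      have : ∀ s, ∫⁻ o, Set.indicator {o : Outcome ι | o.1 j = true}ᶜ 1 o
        ∂((mech i (offered (x i) s)).1 ∘ₘ D i) + ∫⁻ o, Set.indicator {o : Outcome ι | o.1 j = true} 1 o
        ∂((mech i (offered (x i) s)).1 ∘ₘ D i) = (1 : ℝ≥0∞) := by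
        intro s
        rw [lintegral_indicator_one hmo, lintegral_indicator_one hmo.compl, add_comm,
          measure_add_measure_compl hmo, measure_univ]
      simp [this]
    rw [Set.indicator_of_mem (show q ∈ {q : State n ι | q.1 j ≤ l} from h.le),
      Set.indicator_of_mem (show q ∈ {q : State n ι | q.1 j = l} from h), Pi.one_apply, mul_one]
    exact h4.le.trans (add_le_add_right h3 _)
  · rw [Set.indicator_of_notMem (show q ∉ {q : State n ι | q.1 j ≤ l} from not_le.2 h)]
    exact zero_le

end Average

/-! ### Stochastic domination of the broken wands and the offer probability `γ`. -/

section Average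

variable {n : ℕ} {ι : Type*} [Fintype ι] [DecidableEq ι] {T : Fin n → Type*}
  [∀ i, MeasurableSpace (T i)]
  (γ : ℝ) (x : Fin n → ι → ℝ) (mech : ∀ i, (ι → ℝ) → Mech (T i) (Outcome ι))
  (D : ∀ i, Measure (T i))

theorem boxes_coe {ι : Type*} (x : Fin n → ι → ℝ) (j : ι) (i : Fin n) : boxes x j i = x i j := by
  simp [boxes]

theorem boxes_mem {ι : Type*} {x : Fin n → ι → ℝ} (hx : ∀ i, x i ∈ cube ι) (j : ι) (i : ℕ) :
    boxes x j i ∈ Set.Icc (0 : ℝ) 1 := by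
  unfold boxes
  split_ifs with h
  · exact ⟨(hx _).1 j, (hx _).2 j⟩
  · simp

theorem openProb_mem (hγ0 : 0 ≤ γ) (hγ1 : γ ≤ 1) {y : ℕ → ℝ} {i : ℕ}
    (hy : ∀ a < i, y a ∈ Set.Icc (0 : ℝ) 1) (w : ℕ) : openProb γ y i w ∈ Set.Icc (0 : ℝ) 1 :=
  (isCountCDF_brokenCDF hγ0 hγ1 hy).openProbOf_mem hγ0 hγ1 _

/-- The law of the set of items that are offered to buyer `i`, averaged over the types. -/
noncomputable def avgOfferLaw (i : Fin n) : Measure (ι → Bool) :=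
  offerLaw γ x mech i ∘ₘ Measure.pi D

theorem avgOfferLaw_apply_setOf (hγ0 : 0 ≤ γ) (hγ1 : γ ≤ 1) (hx : ∀ i, x i ∈ cube ι) (i : Fin n)
    (j : ι) :
    avgOfferLaw γ x mech D i {s | s j = true} =
      ∫⁻ q, ENNReal.ofReal (openProb γ (boxes x j) i (q.1 j))
        ∂(stateAfter γ x mech i ∘ₘ Measure.pi D) := by
  have hm : Measurable fun q : State n ι =>
      ENNReal.ofReal (openProb γ (boxes x j) i (q.1 j)) :=
    (measurable_of_countable fun w : ℕ => ENNReal.ofReal (openProb γ (boxes x j) i w)).comp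
      (f := fun q : State n ι => q.1 j) (by fun_prop)
  have hs : MeasurableSet {s : ι → Bool | s j = true} := (Set.toFinite _).measurableSet
  rw [avgOfferLaw, Measure.bind_apply hs (Kernel.aemeasurable _),
    Measure.lintegral_bind (Kernel.aemeasurable _) hm.aemeasurable]
  refine lintegral_congr fun θ => ?_
  rw [← lintegral_indicator_one hs, lintegral_offerLaw]
  refine lintegral_congr fun q => ?_
  rw [lintegral_indicator_one hs,
    openLaw_apply_setOf γ x i q.1 j (openProb_mem γ hγ0 hγ1 (fun a _ => boxes_mem hx j a) _)]

variable [∀ i, IsProbabilityMeasure (D i)]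

instance (i : Fin n) : IsProbabilityMeasure (avgOfferLaw γ x mech D i) := by
  unfold avgOfferLaw
  infer_instance

/-- The number of broken wands is stochastically dominated by the computed distribution. -/
theorem brokenCDF_le_bind_stateAfter (hγ0 : 0 ≤ γ) (hγ1 : γ ≤ 1) (hx : ∀ i, x i ∈ cube ι)
    (hE : ∀ i, ∀ x ∈ cube ι, ∀ j, exAnte (D i) (mech i x) j ≤ x j) (j : ι) {r : ℕ} (hr : r ≤ n)
    (l : ℤ) :
    brokenCDF γ (boxes x j) r l ≤
      (stateAfter γ x mech r ∘ₘ Measure.pi D).real {q | (q.1 j : ℤ) ≤ l} := by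
  rcases lt_or_ge l 0 with hl | hl
  · rw [(isCountCDF_brokenCDF hγ0 hγ1 fun a _ => boxes_mem hx j a).neg l hl]
    exact measureReal_nonneg
  induction r generalizing l with
  | zero =>
    refine ((isCountCDF_brokenCDF hγ0 hγ1 fun a _ => boxes_mem hx j a).le_one l).trans ?_
    have : (stateAfter γ x mech 0 ∘ₘ Measure.pi D) {q | (q.1 j : ℤ) ≤ l} = 1 := by
      have hs : stateAfter γ x mech 0 =
        Kernel.const _ (Measure.dirac (fun _ => 0, fun _ => (fun _ => false, 0))) := rfl
      rw [hs, Measure.const_comp, measure_univ, one_smul, Measure.dirac_apply' _ ?_]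
      · simp [hl]
      · exact measurableSet_le ((measurable_of_countable fun w : ℕ => (w : ℤ)).comp
          (f := fun q : State n ι => q.1 j) (by fun_prop)) measurable_const
    simp [Measure.real, this]
  | succ r ih =>
    have hF := isCountCDF_brokenCDF hγ0 hγ1 (i := r) fun a _ => boxes_mem hx j a
    set μ := stateAfter γ x mech r ∘ₘ Measure.pi D with hμ
    set μ' := stateAfter γ x mech (r + 1) ∘ₘ Measure.pi D with hμ'
    have ih' : ∀ l, brokenCDF γ (boxes x j) r l ≤ μ.real {q | (q.1 j : ℤ) ≤ l} := by
      intro l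
      rcases lt_or_ge l 0 with hl | hl
      · rw [hF.neg l hl]
        exact measureReal_nonneg
      · exact ih (by omega) l hl
    lift l to ℕ using hl
    have hp := openProb_mem γ hγ0 hγ1 (i := r) (fun a _ => boxes_mem hx j a)
    have hm : MeasurableSet {q : State n ι | q.1 j = l} :=
      measurableSet_eq_fun (f := fun q : State n ι => q.1 j) (by fun_prop) measurable_const
    have hle := bind_stateAfter_le γ x mech D ⟨r, hr⟩ j hp
      (fun s => hE _ _ (offered_mem_cube (hx _) s) j) l
    have hsplit : μ.real {q | (q.1 j : ℤ) ≤ l} =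
        μ.real {q | (q.1 j : ℤ) ≤ (l : ℤ) - 1} + μ.real {q | q.1 j = l} := by
      rw [← measureReal_union _ hm]
      · congr 1
        ext q
        simp only [Set.mem_ofPred_eq, Set.mem_union]
        omega
      · rw [Set.disjoint_left]
        intro q h1 h2
        simp only [Set.mem_ofPred_eq] at h1 h2
        omega
    have hbox : x ⟨r, hr⟩ j = boxes x j r := (boxes_coe x j ⟨r, hr⟩).symm
    have hb := boxes_mem hx j r
    have hsb : 0 ≤ openProb γ (boxes x j) r l * boxes x j r := mul_nonneg (hp l).1 hb.1
    have hsb1 : openProb γ (boxes x j) r l * boxes x j r ≤ 1 := mul_le_one₀ (hp l).2 hb.1 hb.2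
    have hreal : μ.real {q | (q.1 j : ℤ) ≤ l} ≤ μ'.real {q | (q.1 j : ℤ) ≤ l} +
        openProb γ (boxes x j) r l * boxes x j r * μ.real {q | q.1 j = l} := by
      simp only [Nat.cast_le]
      rw [hbox] at hle
      have := ENNReal.toReal_mono (by finiteness) hle
      rwa [ENNReal.toReal_add (by finiteness) (by finiteness), ENNReal.toReal_mul,
        ENNReal.toReal_ofReal hsb] at this
    rw [brokenCDF, if_pos (by omega)]
    change openProb γ (boxes x j) r l * boxes x j r * brokenCDF γ (boxes x j) r (l - 1) +
      (1 - openProb γ (boxes x j) r l * boxes x j r) * brokenCDF γ (boxes x j) r l ≤ _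
    -- The computed step is a convex combination of the CDF at `l - 1` and at `l`. Bounding both by
    -- the true probabilities of `W` broken wands gives `P(W ≤ l) - s x P(W = l)`, with `s` the
    -- opening probability and `x` the written one; the true process stays above this by `hreal`.
    have h1 := mul_le_mul_of_nonneg_left (ih' (l - 1)) hsb
    have h2 := mul_le_mul_of_nonneg_left (ih' l) (sub_nonneg.2 hsb1)
    have h3 : μ.real {q | q.1 j = l} =
      μ.real {q | (q.1 j : ℤ) ≤ l} - μ.real {q | (q.1 j : ℤ) ≤ (l : ℤ) - 1} := by linarith
    rw [h3] at hreal
    linarith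

theorem le_avgOfferLaw (hγ0 : 0 ≤ γ) (hγ1 : γ ≤ 1) (hx : ∀ i, x i ∈ cube ι)
    (hE : ∀ i, ∀ x ∈ cube ι, ∀ j, exAnte (D i) (mech i x) j ≤ x j) (i : Fin n) (j : ι) :
    γ ≤ (avgOfferLaw γ x mech D i).real {s | s j = true} := by
  have hF := isCountCDF_brokenCDF hγ0 hγ1 (i := i) fun a _ => boxes_mem hx j a
  have hle := brokenCDF_le_bind_stateAfter γ x mech D hγ0 hγ1 hx hE j i.2.le
  set μ := stateAfter γ x mech i ∘ₘ Measure.pi D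
  set F := brokenCDF γ (boxes x j) i with hFdef
  set t := thresholdOf γ F with ht
  set c := openProbOf γ F t with hc
  have hc01 : c ∈ Set.Icc (0 : ℝ) 1 := hF.openProbOf_mem hγ0 hγ1 _
  have hm : ∀ l : ℤ, MeasurableSet {q : State n ι | (q.1 j : ℤ) ≤ l} := fun l =>
    measurableSet_le ((measurable_of_countable fun w : ℕ => (w : ℤ)).comp
      (f := fun q : State n ι => q.1 j) (by fun_prop)) measurable_const
  -- The opening probability is a decreasing step function of the broken wands, hence a mixture of
  -- two indicators of lower sets, to which domination applies.
  have hpt : ∀ q : State n ι,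
      ENNReal.ofReal (1 - c) * Set.indicator {q : State n ι | (q.1 j : ℤ) ≤ (t : ℤ) - 1} 1 q +
        ENNReal.ofReal c * Set.indicator {q : State n ι | (q.1 j : ℤ) ≤ (t : ℤ)} 1 q ≤
      ENNReal.ofReal (openProb γ (boxes x j) i (q.1 j)) := by
    intro q
    rcases lt_trichotomy (q.1 j) t with h | h | h
    · rw [Set.indicator_of_mem (by simp only [Set.mem_ofPred_eq]; omega),
        Set.indicator_of_mem (by simp only [Set.mem_ofPred_eq]; omega), openProb, openProbOf,
        ← hFdef, if_pos (by omega)]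
      simp only [Pi.one_apply, mul_one]
      rw [← ENNReal.ofReal_add (sub_nonneg.2 hc01.2) hc01.1, sub_add_cancel]
    · rw [Set.indicator_of_notMem (by simp only [Set.mem_ofPred_eq]; omega),
        Set.indicator_of_mem (by simp only [Set.mem_ofPred_eq]; omega), openProb, h]
      simp [hc, ← hFdef]
    · rw [Set.indicator_of_notMem (by simp only [Set.mem_ofPred_eq]; omega),
        Set.indicator_of_notMem (by simp only [Set.mem_ofPred_eq]; omega)]
      simp
  have h1 : ENNReal.ofReal (1 - c) * μ {q | (q.1 j : ℤ) ≤ (t : ℤ) - 1} +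
      ENNReal.ofReal c * μ {q | (q.1 j : ℤ) ≤ (t : ℤ)} ≤
      avgOfferLaw γ x mech D i {s | s j = true} := by
    rw [avgOfferLaw_apply_setOf γ x mech D hγ0 hγ1 hx, ← lintegral_indicator_one (hm _),
      ← lintegral_indicator_one (hm _), ← lintegral_const_mul _ (measurable_one.indicator (hm _)),
      ← lintegral_const_mul _ (measurable_one.indicator (hm _)),
      ← lintegral_add_left ((measurable_one.indicator (hm _)).const_mul _)]
    exact lintegral_mono hpt
  have h2 := ENNReal.toReal_mono (by finiteness) h1
  rw [ENNReal.toReal_add (by finiteness) (by finiteness), ENNReal.toReal_mul, ENNReal.toReal_mul,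
    ENNReal.toReal_ofReal (sub_nonneg.2 hc01.2), ENNReal.toReal_ofReal hc01.1] at h2
  refine le_trans ?_ h2
  -- Under the computed CDF the mixture has mean `(1 - c) * F (t - 1) + c * F t = γ`.
  have h3 := hF.openProbOf_mul_sub hγ0 hγ1 t
  rw [min_eq_right (hF.le_thresholdOf hγ1), min_eq_left (hF.thresholdOf_sub_one_le hγ0)] at h3
  have h4 := mul_le_mul_of_nonneg_left (hle (t - 1)) (sub_nonneg.2 hc01.2)
  have h5 := mul_le_mul_of_nonneg_left (hle t) hc01.1
  simp only [Measure.real] at h4 h5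
  linarith

end Average

/-- If every item is offered with probability at least `γ`, a benchmark with a cross monotonic
cost sharing scheme retains a `γ`-fraction of its value. -/
theorem HasCostSharing.mul_le_sum {ι : Type*} [Fintype ι] [DecidableEq ι] {R : (ι → ℝ) → ℝ}
    (hR : HasCostSharing R) {x : ι → ℝ} (hx : x ∈ cube ι) {γ : ℝ} {μ : Measure (ι → Bool)}
    [IsFiniteMeasure μ] (hμ : ∀ j, γ ≤ μ.real {s | s j = true}) :
    γ * R x ≤ ∑ s, μ.real {s} * R (offered x s) := by
  obtain ⟨-, ξ, hξ0, hξR, hξm⟩ := hR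
  have huniv : induced x Finset.univ = x := by
    ext j
    simp [induced]
  have h1 : R x = ∑ j, ξ j x := by
    have := hξR x hx Finset.univ
    rw [huniv] at this
    exact this.symm
  -- Cross-monotonicity with `S'` the set of all items: shares within `x[S]` are at least those
  -- within `x`.
  have h2 : ∀ s : ι → Bool, ∑ j, (if s j = true then ξ j x else 0) ≤ R (offered x s) := by
    intro s
    rw [offered, ← hξR x hx, ← Finset.sum_filter]
    refine Finset.sum_le_sum fun j hj => ?_
    have := hξm x hx (Finset.univ.filter fun j => s j = true) Finset.univ j hj
    rwa [Finset.union_eq_right.2 (Finset.subset_univ _), huniv] at this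
  have h3 : ∀ j, μ.real {s | s j = true} = ∑ s : ι → Bool, if s j = true then μ.real {s} else 0 := by
    intro j
    rw [← Finset.sum_filter, ← measureReal_biUnion_finset]
    · congr 1
      ext s
      simp
    · intro a _ b _ hab
      simpa using hab
    · intro a _
      exact measurableSet_singleton a
  calc γ * R x = ∑ j, γ * ξ j x := by rw [h1, Finset.mul_sum]
    _ ≤ ∑ j, μ.real {s | s j = true} * ξ j x :=
      Finset.sum_le_sum fun j _ => mul_le_mul_of_nonneg_right (hμ j) (hξ0 j x hx)
    _ = ∑ s, μ.real {s} * ∑ j, (if s j = true then ξ j x else 0) := by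
      simp only [h3, Finset.sum_mul, Finset.mul_sum]
      rw [Finset.sum_comm]
      refine Finset.sum_congr rfl fun s _ => Finset.sum_congr rfl fun j _ => ?_
      split_ifs <;> simp
    _ ≤ _ := Finset.sum_le_sum fun s _ => mul_le_mul_of_nonneg_left (h2 s) measureReal_nonneg

theorem coe_ereal_sum {S : Type*} (A : Finset S) (f : S → ℝ) :
    ((∑ s ∈ A, f s : ℝ) : EReal) = ∑ s ∈ A, (f s : EReal) :=
  map_sum (⟨⟨fun r : ℝ => (r : EReal), EReal.coe_zero⟩, EReal.coe_add⟩ : ℝ →+ EReal) f A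

/-! ## Mixtures of mechanisms -/

section Mixture

variable {X Y : Type*} [MeasurableSpace X] [MeasurableSpace Y]

theorem exists_mixture (β : ℝ≥0) (hβ : β ≤ 1) (M M' : Mech X Y) :
    ∃ M'' : Mech X Y, ∀ x, M''.1 x = β • M.1 x + (1 - β) • M'.1 x := by
  refine ⟨⟨⟨fun x => β • M.1 x + (1 - β) • M'.1 x, ?_⟩, ⟨fun x => ⟨?_⟩⟩⟩, fun x => rfl⟩
  · refine Measure.measurable_of_measurable_coe _ fun s hs => ?_
    simp only [Measure.add_apply, Measure.smul_apply]
    exact ((M.1.measurable_coe hs).const_smul β).add ((M'.1.measurable_coe hs).const_smul (1 - β))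
  · change (β • M.1 x + (1 - β) • M'.1 x) Set.univ = 1
    simp only [Measure.add_apply, Measure.smul_apply, measure_univ, ENNReal.smul_def, smul_eq_mul,
      mul_one]
    rw [← ENNReal.coe_add, add_tsub_cancel_of_le hβ, ENNReal.coe_one]

theorem IsConvexClass.exists_sum_mem {K : Set (Mech X Y)} (hK : IsConvexClass K) {S : Type*}
    {N : S → Mech X Y} (hN : ∀ s, N s ∈ K) (A : Finset S) (c : S → ℝ≥0) (hc : ∑ s ∈ A, c s = 1) :
    ∃ M ∈ K, ∀ x, M.1 x = ∑ s ∈ A, c s • (N s).1 x := by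
  classical
  induction A using Finset.induction_on generalizing c with
  | empty => simp at hc
  | insert a A ha ih =>
    rw [Finset.sum_insert ha] at hc
    set b := ∑ s ∈ A, c s with hb
    by_cases hb0 : b = 0
    · refine ⟨N a, hN a, fun x => ?_⟩
      rw [Finset.sum_insert ha, Finset.sum_eq_zero, add_zero]
      · rw [hb0, add_zero] at hc
        rw [hc, one_smul]
      · intro s hs
        rw [(Finset.sum_eq_zero_iff.1 hb0) s hs, zero_smul]
    -- The remaining weights are renormalised to total one, and the resulting mechanism is mixed
    -- with `N a`.
    · obtain ⟨M, hM, hMx⟩ := ih (fun s => c s / b) (by rw [← Finset.sum_div, div_self hb0])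
      have hca : c a ≤ 1 := hc ▸ le_self_add
      have hcb : 1 - c a = b := by rw [← hc, add_tsub_cancel_left]
      obtain ⟨M'', hM''⟩ := exists_mixture (c a) hca (N a) M
      refine ⟨M'', hK _ (hN a) _ hM _ hca _ hM'', fun x => ?_⟩
      rw [hM'', hMx, Finset.sum_insert ha, hcb, Finset.smul_sum]
      congr 1
      refine Finset.sum_congr rfl fun s _ => ?_
      rw [smul_smul, mul_div_cancel₀ _ hb0]

theorem IsConvexClass.mem_of_eq_sum {K : Set (Mech X Y)} (hK : IsConvexClass K) {S : Type*}
    [Fintype S] [MeasurableSpace S] [MeasurableSingletonClass S]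
    {N : S → Mech X Y} (hN : ∀ s, N s ∈ K) (μ : Measure S) [IsProbabilityMeasure μ] {M : Mech X Y}
    (hM : ∀ x, M.1 x = ∑ s, μ {s} • (N s).1 x) : M ∈ K := by
  have hc : ∀ s, ((μ {s}).toNNReal : ℝ≥0∞) = μ {s} := fun s =>
    ENNReal.coe_toNNReal (measure_ne_top _ _)
  obtain ⟨M', hM', hx⟩ := hK.exists_sum_mem hN Finset.univ (fun s => (μ {s}).toNNReal) (by
    rw [← ENNReal.coe_inj, ENNReal.ofNNReal_finsetSum, ENNReal.coe_one]
    simp_rw [hc]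
    simp)
  have : M = M' := by
    refine Subtype.ext (Kernel.ext fun x => ?_)
    rw [hM, hx]
    refine Finset.sum_congr rfl fun s _ => ?_
    rw [ENNReal.smul_def, hc]
  rwa [this]

end Mixture

/-! ### Convexity of the single buyer classes and the upper bound by the benchmark program. -/

section Multi

variable {n : ℕ} {ι : Type*} {T : Fin n → Type*} [∀ i, MeasurableSpace (T i)]
  (D : ∀ i, Measure (T i)) [∀ i, IsProbabilityMeasure (D i)]

/-- Passing to the perceived mechanism is linear, so a mixture of perceived mechanisms is perceived
in the mixture. -/
theorem isConvexClass_singleClass {C : Set (Mech (∀ i, T i) (Fin n → Outcome ι))}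
    (hC : IsConvexClass C) (i : Fin n) : IsConvexClass (singleClass D C i) := by
  rintro _ ⟨M, hM, rfl⟩ _ ⟨M', hM', rfl⟩ β hβ N hN
  obtain ⟨M'', hM''⟩ := exists_mixture β hβ M M'
  refine ⟨M'', hC M hM M' hM' β hβ M'' hM'', Subtype.ext (Kernel.ext fun t => ?_)⟩
  refine Measure.ext_of_lintegral _ fun f hf => ?_
  have hm : ∀ M : Mech (∀ i, T i) (Fin n → Outcome ι),
      Measurable fun θ => ∫⁻ o, f (o i) ∂M.1 (Function.update θ i t) := fun M =>
    (Measurable.lintegral_kernel (κ := M.1) (f := fun o => f (o i)) (by fun_prop)).comp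
      ((measurable_update_pair i).comp measurable_prodMk_left)
  rw [hN, lintegral_add_measure, lintegral_smul_measure, lintegral_smul_measure,
    lintegral_inducedMech D i _ t hf, lintegral_inducedMech D i _ t hf,
    lintegral_inducedMech D i _ t hf]
  simp_rw [hM'', lintegral_add_measure, lintegral_smul_measure, ENNReal.smul_def, smul_eq_mul]
  rw [lintegral_add_left ((hm M).const_mul _), lintegral_const_mul _ (hm M),
    lintegral_const_mul _ (hm M')]

theorem exAnte_mem {X : Type*} [MeasurableSpace X] (D : Measure X) [IsProbabilityMeasure D]
    (N : Mech X (Outcome ι)) : exAnte D N ∈ cube ι :=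
  ⟨fun _ => measureReal_nonneg, fun _ => measureReal_le_one⟩

/-- The sum is the expected number of units of `j` allocated, and supply holds almost surely at
every profile. -/
theorem sum_exAnte_inducedMech_le [DecidableEq ι] {k : ι → ℕ}
    {M : Mech (∀ i, T i) (Fin n → Outcome ι)} (hM : Supply k M) (j : ι) :
    ∑ i, exAnte (D i) (inducedMech D i M) j ≤ k j := by
  have hme : ∀ i : Fin n, MeasurableSet {z : (∀ i, T i) × (Fin n → Outcome ι) | (z.2 i).1 j = true} :=
    fun i => measurableSet_eq_fun (f := fun z : (∀ i, T i) × (Fin n → Outcome ι) => (z.2 i).1 j)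
      (by fun_prop) measurable_const
  have h1 : ∀ i, exAnte (D i) (inducedMech D i M) j =
      (Measure.pi D ⊗ₘ M.1).real {z | (z.2 i).1 j = true} := by
    intro i
    have hm : MeasurableSet {z : T i × Outcome ι | z.2.1 j = true} :=
      measurableSet_eq_fun (f := fun z : T i × Outcome ι => z.2.1 j) (by fun_prop) measurable_const
    rw [exAnte, ← map_pi_compProd, map_measureReal_apply (by fun_prop) hm]
    rfl
  have h2 : ∑ i, (Measure.pi D ⊗ₘ M.1) {z | (z.2 i).1 j = true} ≤ k j := by
    simp_rw [← lintegral_indicator_one (hme _)]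
    rw [← lintegral_finsetSum _ fun i _ => measurable_one.indicator (hme i),
      Measure.lintegral_compProd
        (Finset.measurable_fun_sum _ fun i _ => measurable_one.indicator (hme i))]
    have h3 : ∀ θ, ∫⁻ o, ∑ i, Set.indicator
        {z : (∀ i, T i) × (Fin n → Outcome ι) | (z.2 i).1 j = true} 
        (1 : (∀ i, T i) × (Fin n → Outcome ι) → ℝ≥0∞) (θ, o) ∂M.1 θ
        ≤ k j := by
      intro θ
      calc _ ≤ ∫⁻ _, (k j : ℝ≥0∞) ∂M.1 θ := by
            refine lintegral_mono_ae ?_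
            filter_upwards [hM θ] with o ho
            have := ho j
            rw [Finset.card_filter] at this
            simp only [Set.indicator_apply, Set.mem_ofPred_eq, Pi.one_apply]
            exact_mod_cast this
        _ = k j := by simp
    exact (lintegral_mono h3).trans (by simp)
  simp only [h1, Measure.real]
  rw [← ENNReal.toReal_sum fun i _ => measure_ne_top _ _]
  exact (ENNReal.toReal_mono (by simp) h2).trans (by simp)

/-- The ex ante allocations of `M` form a feasible assignment `y`; each buyer contributes at most `R
i (y i)`, and `x` is optimal. -/
theorem value_le_sum [DecidableEq ι] [Fintype ι] {k : ι → ℕ}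
    {C : Set (Mech (∀ i, T i) (Fin n → Outcome ι))} (hdec : IsDecomposable k D C)
    {obj : ∀ i, T i → Outcome ι → ℝ}
    (hobj : ∀ i, Measurable fun z : T i × Outcome ι => obj i z.1 z.2)
    {α : ℝ} {mech : ∀ i, (ι → ℝ) → Mech (T i) (Outcome ι)} {R : Fin n → (ι → ℝ) → ℝ}
    (happrox : ∀ i, IsApproxSingle (D i) (obj i) (singleClass D C i) α (mech i) (R i))
    {x : Fin n → ι → ℝ} (hx : IsOptimalAssignment k R x) {M : Mech (∀ i, T i) (Fin n → Outcome ι)}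
    (hM : M ∈ C) : value D obj M ≤ ((∑ i, R i (x i) : ℝ) : EReal) := by
  let y : Fin n → ι → ℝ := fun i => exAnte (D i) (inducedMech D i M)
  have hy : IsAssignment k y :=
    ⟨fun i => exAnte_mem _ _, fun j => sum_exAnte_inducedMech_le D (hdec.1 M hM) j⟩
  refine le_trans ?_ (EReal.coe_le_coe_iff.2 (hx.2 y hy))
  rw [coe_ereal_sum]
  refine Finset.sum_le_sum fun i _ => ?_
  rw [expect_pi_compProd D i M (hobj i)]
  exact (happrox i).upper (y i) (hy.1 i) _ ⟨M, hM, rfl⟩ fun j => le_rfl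

end Multi

/-! ### The mechanism perceived under pre-rounding and its value. -/

section PreRounding

variable {n : ℕ} {ι : Type*} [Fintype ι] [DecidableEq ι] {T : Fin n → Type*}
  [∀ i, MeasurableSpace (T i)]
  (γ : ℝ) (x : Fin n → ι → ℝ) (mech : ∀ i, (ι → ℝ) → Mech (T i) (Outcome ι))
  (D : ∀ i, Measure (T i)) [∀ i, IsProbabilityMeasure (D i)]

/-- The weights do not depend on `t` because offers ignore the buyer's own report. This one mixture
gives both membership in the convex class and the value bound. -/
theorem inducedMech_preRounding (i : Fin n) (t : T i) :
    (inducedMech D i (preRounding γ x mech)).1 t =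
      ∑ s, avgOfferLaw γ x mech D i {s} • (mech i (offered (x i) s)).1 t := by
  refine Measure.ext_of_lintegral _ fun f hf => ?_
  rw [lintegral_inducedMech D i _ t hf, lintegral_finsetSum_measure]
  have h : ∀ θ, ∫⁻ o, f (o i) ∂(preRounding γ x mech).1 (Function.update θ i t) =
      ∑ s, offerLaw γ x mech i θ {s} * ∫⁻ o, f o ∂(mech i (offered (x i) s)).1 t := by
    intro θ
    rw [← lintegral_map hf (measurable_pi_apply i), map_preRounding, lintegral_finsetSum_measure,
      offerLaw_update, Function.update_self]
    simp only [lintegral_smul_measure, smul_eq_mul]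
  have hm : ∀ s, Measurable fun θ => offerLaw γ x mech i θ {s} := fun s =>
    (offerLaw γ x mech i).measurable_coe (measurableSet_singleton s)
  simp_rw [h]
  rw [lintegral_finsetSum _ fun s _ => (hm s).mul_const _]
  refine Finset.sum_congr rfl fun s _ => ?_
  rw [lintegral_mul_const _ (hm s), lintegral_smul_measure, smul_eq_mul, avgOfferLaw,
    Measure.bind_apply (measurableSet_singleton s) (Kernel.aemeasurable _)]

theorem compProd_inducedMech_preRounding (i : Fin n) :
    D i ⊗ₘ (inducedMech D i (preRounding γ x mech)).1 =
      ∑ s, avgOfferLaw γ x mech D i {s} • (D i ⊗ₘ (mech i (offered (x i) s)).1) := by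
  refine Measure.ext_of_lintegral _ fun f hf => ?_
  rw [Measure.lintegral_compProd hf, lintegral_finsetSum_measure]
  simp_rw [inducedMech_preRounding, lintegral_finsetSum_measure, lintegral_smul_measure,
    smul_eq_mul]
  have hm : ∀ s, Measurable fun t => ∫⁻ o, f (t, o) ∂(mech i (offered (x i) s)).1 t := fun s =>
    hf.lintegral_kernel_prod_right'
  rw [lintegral_finsetSum _ fun s _ => (hm s).const_mul _]
  refine Finset.sum_congr rfl fun s _ => ?_
  rw [lintegral_const_mul _ (hm s), Measure.lintegral_compProd hf]

theorem le_value_preRounding {obj : ∀ i, T i → Outcome ι → ℝ}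
    (hobj : ∀ i, Measurable fun z : T i × Outcome ι => obj i z.1 z.2)
    {C : Set (Mech (∀ i, T i) (Fin n → Outcome ι))} {α : ℝ} (hα : 0 ≤ α) {R : Fin n → (ι → ℝ) → ℝ}
    (happrox : ∀ i, IsApproxSingle (D i) (obj i) (singleClass D C i) α (mech i) (R i))
    (hshare : ∀ i, HasCostSharing (R i)) (hγ0 : 0 ≤ γ) (hγ1 : γ ≤ 1) (hx : ∀ i, x i ∈ cube ι) :
    ((γ * α * ∑ i, R i (x i) : ℝ) : EReal) ≤ value D obj (preRounding γ x mech) := by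
  rw [Finset.mul_sum, coe_ereal_sum]
  refine Finset.sum_le_sum fun i _ => ?_
  rw [expect_pi_compProd D i _ (hobj i), singleValue, compProd_inducedMech_preRounding,
    expect_sum_smul_measure _ fun s => measure_ne_top _ _]
  have h1 : γ * α * R i (x i) ≤
      ∑ s, (avgOfferLaw γ x mech D i).real {s} * (α * R i (offered (x i) s)) := by
    have := mul_le_mul_of_nonneg_left ((hshare i).mul_le_sum (hx i) (γ := γ)
      (μ := avgOfferLaw γ x mech D i) fun j => le_avgOfferLaw γ x mech D hγ0 hγ1 hx
        (fun i => (happrox i).exAnte_le) i j) hα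
    rw [Finset.mul_sum] at this
    refine (le_of_eq (by ring)).trans (this.trans (le_of_eq ?_))
    exact Finset.sum_congr rfl fun s _ => by ring
  refine (EReal.coe_le_coe_iff.2 h1).trans ?_
  rw [coe_ereal_sum]
  refine Finset.sum_le_sum fun s _ => ?_
  rw [EReal.coe_mul]
  have h2 : (((avgOfferLaw γ x mech D i).real {s} : ℝ) : EReal) =
      ((avgOfferLaw γ x mech D i {s} : ℝ≥0∞) : EReal) := by
    exact EReal.coe_ennreal_toReal (measure_ne_top _ _)
  rw [h2]
  exact mul_le_mul_of_nonneg_left ((happrox i).lower _ (offered_mem_cube (hx i) s))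
    (EReal.coe_ennreal_nonneg _)

end PreRounding

end Auction

theorem mainTheorem2 {n : ℕ} {ι : Type*} [Fintype ι] [DecidableEq ι] [Nonempty ι]
    -- supplies, type spaces, independent priors, objective and utility functions
    (k : ι → ℕ) (hk : ∀ j, 0 < k j)
    {T : Fin n → Type*} [∀ i, MeasurableSpace (T i)]
    (D : ∀ i, Measure (T i)) [∀ i, IsProbabilityMeasure (D i)]
    (obj : ∀ i, T i → Auction.Outcome ι → ℝ)
    (hobj : ∀ i, Measurable fun z : T i × Auction.Outcome ι => obj i z.1 z.2)
    (util : ∀ i, T i → Auction.Outcome ι → EReal)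
    (hutil : ∀ i t, Measurable (util i t))
    -- the space of feasible mechanisms
    (C : Set (Auction.Mech (∀ i, T i) (Fin n → Auction.Outcome ι)))
    (hconv : Auction.IsConvexClass C)
    (hdec : Auction.IsDecomposable k D C)
    -- the single buyer mechanisms and their benchmarks
    (α : ℝ) (hα : 0 ≤ α)
    (mech : ∀ i, (ι → ℝ) → Auction.Mech (T i) (Auction.Outcome ι))
    (R : Fin n → (ι → ℝ) → ℝ)
    (happrox : ∀ i, Auction.IsApproxSingle (D i) (obj i) (Auction.singleClass D C i) α
      (mech i) (R i))
    (hIC : ∀ i, ∀ x ∈ Auction.cube ι, Auction.IsIC (util i) (mech i x))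
    -- an item with bound zero (an item which is not offered) is never allocated
    (hzero : ∀ i, ∀ x ∈ Auction.cube ι, ∀ j, x j = 0 →
      ∀ t, ∀ᵐ o ∂((mech i x).1 t), o.1 j = false)
    (hshare : ∀ i, Auction.HasCostSharing (R i))
    -- the parameter, and an optimal assignment of the benchmark program
    (γ : ℝ) (hγ0 : 0 ≤ γ)
    (hγ : γ ≤ Auction.gammaOpt (Finset.univ.inf' Finset.univ_nonempty k))
    (x : Fin n → ι → ℝ) (hx : Auction.IsOptimalAssignment k R x) :
    Auction.IsDSIC util (Auction.preRounding γ x mech) ∧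
      Auction.preRounding γ x mech ∈ C ∧
      Auction.IsApproxOptimal D obj C (γ * α) (Auction.preRounding γ x mech) := by
  have hk0 : 0 < Finset.univ.inf' Finset.univ_nonempty k := by
    rw [Finset.lt_inf'_iff]
    exact fun j _ => hk j
  have hγ1 : γ ≤ 1 := hγ.trans (Auction.gammaOpt_mem hk0).2.1
  have hcube : ∀ i, x i ∈ Auction.cube ι := hx.1.1
  have hthreshold : ∀ (i : Fin n) (j : ι), Auction.threshold γ (Auction.boxes x j) i < k j := by
    intro i j
    -- `gammaOpt` is uniform over all supplies `k' ≥ k`, so the minimal supply gives one `γ` for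
    -- every item; here `k' = k j`.
    refine Auction.threshold_lt_of_le_gammaOpt hk0 hγ0 hγ
      (Finset.inf'_le _ (Finset.mem_univ j)) (N := n)
      (fun a _ => Auction.boxes_mem hcube j a) ?_ i.2
    rw [← Fin.sum_univ_eq_sum_range]
    simpa only [Auction.boxes_coe] using hx.1.2 j
  have hmem : Auction.preRounding γ x mech ∈ C := by
    refine hdec.2 _ (Auction.supply_preRounding γ x mech k
      (fun i j w => Auction.openProb_mem γ hγ0 hγ1 (fun a _ => Auction.boxes_mem hcube j a) w)
      hthreshold hcube hzero) fun i => ?_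
    exact (Auction.isConvexClass_singleClass D hconv i).mem_of_eq_sum
      (fun s => (happrox i).mem _ (Auction.offered_mem_cube (hcube i) s))
      (Auction.avgOfferLaw γ x mech D i) (Auction.inducedMech_preRounding γ x mech D i)
  refine ⟨Auction.isDSIC_preRounding γ x mech hutil hcube hIC, hmem, hmem, fun M hM => ?_⟩
  have h1 := mul_le_mul_of_nonneg_left (Auction.value_le_sum D hdec hobj happrox hx hM)
    (EReal.coe_nonneg.2 (mul_nonneg hγ0 hα))
  rw [← EReal.coe_mul] at h1
  exact h1.trans
    (Auction.le_value_preRounding γ x mech D hobj hα happrox hshare hγ0 hγ1 hcube)
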